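/- For a domain $D\subset\mathbb{C}^n$, $n\ge 1$, let $k_D$ denote the Kobayashi pseudodistance of $D$ (normalized by the Poincaré distance $\operatorname{artanh}|a|$ between $0$ and $a$ on the unit disc $\mathbb{D}$); $D$ is Kobayashi hyperbolic if $k_D$ is a distance, and $D$ is taut if every sequence of holomorphic maps $\mathbb{D}\to D$ has a subsequence that either converges locally uniformly to a holomorphic map $\mathbb{D}\to D$ or is compactly divergent in $D$. For $z\in D$ and $r>0$ put $B_D^k(z,r)=\{w\in D: k_D(z,w)<r\}$. Let $\Omega\subset\mathbb{C}^n$ be a bounded homogeneous domain, i.e. a bounded domain whose group of biholomorphic automorphisms acts transitively. For a Kobayashi hyperbolic domain $D\subset\mathbb{C}^n$ and $z\in D$ let $$h_D^\Omega(z)=\inf\{1/r:\ r>0,\ B_D^k(z,r)\subset f(\Omega)\text{ for some injective holomorphic } f:\Omega\to D\},$$ and let $e_D^\Omega(z)=\tanh\big(1/h_D^\Omega(z)\big)$ be the Fridman invariant, with the convention $e_D^\Omega(z)=1$ if $h_D^\Omega(z)=0$. Theorem. Let $D\subset\mathbb{C}^n$ be a Kobayashi hyperbolic domain that is bounded or taut,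 and let $\{D_j\}_{j\ge1}$ be a sequence of subdomains of $D$ exhausting $D$, i.e. for every compact $K\subset D$ there is $N$ such that $K\subset D_j$ for all $j>N$. Then for every $z\in D$, $$\limsup_{j\to\infty} e_{D_j}^\Omega(z)\le e_D^\Omega(z).$$ -/

import Mathlib

open Set Filter Topology
open scoped ENNReal

noncomputable section

namespace Fridman

/-- The space `ℂⁿ` with its Euclidean norm. -/
abbrev Cn (n : ℕ) : Type := EuclideanSpace ℂ (Fin n)

/-- The open unit disc in `ℂ`. -/
abbrev disc : Set ℂ := Metric.ball (0 : ℂ) 1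

/-- A domain in `ℂⁿ`: a non-empty, connected, open set. -/
def IsDomain {n : ℕ} (D : Set (Cn n)) : Prop :=
  IsOpen D ∧ IsConnected D

/-- Holomorphic maps from the unit disc into `D`. -/
def IsHolDisc {n : ℕ} (D : Set (Cn n)) (φ : ℂ → Cn n) : Prop :=
  DifferentiableOn ℂ φ disc ∧ MapsTo φ disc D

/-- The Poincaré distance of the unit disc, normalized so that `dist (0, a) = artanh |a|`. -/
def poincareDist (a b : ℂ) : ℝ :=
  Real.artanh ‖(a - b) / (1 - (starRingEnd ℂ) b * a)‖

/-- The Lempert function of `D`: the infimum of the Poincaré distances `p(a, b)` over all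
holomorphic discs `φ` in `D` with `φ a = z` and `φ b = w`. -/
def lempert {n : ℕ} (D : Set (Cn n)) (z w : Cn n) : ℝ≥0∞ :=
  sInf {t | ∃ φ : ℂ → Cn n, IsHolDisc D φ ∧ ∃ a ∈ disc, ∃ b ∈ disc,
    φ a = z ∧ φ b = w ∧ t = ENNReal.ofReal (poincareDist a b)}

/-- The Kobayashi pseudodistance of `D`: the infimum of the lengths of finite chains of
holomorphic discs joining `z` to `w` (it is finite on a domain). -/
def kobayashi {n : ℕ} (D : Set (Cn n)) (z w : Cn n) : ℝ≥0∞ :=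
  sInf {t | ∃ (m : ℕ) (p : ℕ → Cn n), p 0 = z ∧ p (m + 1) = w ∧
    t = ∑ i ∈ Finset.range (m + 1), lempert D (p i) (p (i + 1))}

/-- The open ball in `D` with respect to the Kobayashi pseudodistance. -/
def kobayashiBall {n : ℕ} (D : Set (Cn n)) (z : Cn n) (r : ℝ) : Set (Cn n) :=
  {w | w ∈ D ∧ kobayashi D z w < ENNReal.ofReal r}

/-- `D` is Kobayashi hyperbolic: the Kobayashi pseudodistance is a distance. -/
def IsKobayashiHyperbolic {n : ℕ} (D : Set (Cn n)) : Prop :=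
  ∀ z ∈ D, ∀ w ∈ D, kobayashi D z w = 0 → z = w

/-- `D` is taut: every sequence of holomorphic discs in `D` has a subsequence that either
converges locally uniformly to a holomorphic disc in `D`, or is compactly divergent. -/
def IsTaut {n : ℕ} (D : Set (Cn n)) : Prop :=
  ∀ φ : ℕ → ℂ → Cn n, (∀ j, IsHolDisc D (φ j)) →
    ∃ s : ℕ → ℕ, StrictMono s ∧
      ((∃ ψ : ℂ → Cn n, IsHolDisc D ψ ∧
          TendstoLocallyUniformlyOn (fun j => φ (s j)) ψ atTop disc) ∨
        (∀ K : Set ℂ, IsCompact K → K ⊆ disc → ∀ L : Set (Cn n), IsCompact L → L ⊆ D →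
          ∀ᶠ j in atTop, Disjoint (φ (s j) '' K) L))

/-- The set of injective holomorphic maps from `D₁` into `D₂`. -/
def injHol {n : ℕ} (D₁ D₂ : Set (Cn n)) : Set (Cn n → Cn n) :=
  {f | DifferentiableOn ℂ f D₁ ∧ MapsTo f D₁ D₂ ∧ InjOn f D₁}

/-- `φ` restricts to a biholomorphic automorphism of `Ω`. -/
def IsAut {n : ℕ} (Ω : Set (Cn n)) (φ : Cn n → Cn n) : Prop :=
  DifferentiableOn ℂ φ Ω ∧ MapsTo φ Ω Ω ∧
    ∃ ψ : Cn n → Cn n, DifferentiableOn ℂ ψ Ω ∧ MapsTo ψ Ω Ω ∧ InvOn ψ φ Ω Ω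

/-- `Ω` is homogeneous: its automorphism group acts transitively. -/
def IsHomogeneous {n : ℕ} (Ω : Set (Cn n)) : Prop :=
  ∀ a ∈ Ω, ∀ b ∈ Ω, ∃ φ : Cn n → Cn n, IsAut Ω φ ∧ φ a = b

/-- The hyperbolic tangent on `[0, ∞]`, with `tanh ∞ = 1`. -/
def tanhExt (x : ℝ≥0∞) : ℝ := if x = ⊤ then 1 else Real.tanh x.toReal

/-- `h_D^Ω(z)`: the infimum of `1 / r` over all `r > 0` for which the Kobayashi ball of radius `r`
about `z` is contained in the image of some injective holomorphic map from `Ω` into `D`. -/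
def fridmanH {n : ℕ} (Ω D : Set (Cn n)) (z : Cn n) : ℝ≥0∞ :=
  sInf {t | ∃ r : ℝ, 0 < r ∧ (∃ f ∈ injHol Ω D, kobayashiBall D z r ⊆ f '' Ω) ∧
    t = ENNReal.ofReal (1 / r)}

/-- The Fridman invariant `e_D^Ω(z) = tanh (1 / h_D^Ω(z))`, where `1 / 0 = ∞`. -/
def fridman {n : ℕ} (Ω D : Set (Cn n)) (z : Cn n) : ℝ :=
  tanhExt (fridmanH Ω D z)⁻¹

/-- `(D_j)` is a sequence of subdomains of `D` exhausting `D`. -/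
def Exhausts {n : ℕ} (Dj : ℕ → Set (Cn n)) (D : Set (Cn n)) : Prop :=
  (∀ j, IsDomain (Dj j) ∧ Dj j ⊆ D) ∧
    ∀ K : Set (Cn n), IsCompact K → K ⊆ D → ∃ N : ℕ, ∀ j > N, K ⊆ Dj j

/-- The Fridman invariant takes values in `[0, 1]`, so real upper limits of it are genuine. -/
theorem fridman_mem_Icc {n : ℕ} (Ω D : Set (Cn n)) (z : Cn n) :
    fridman Ω D z ∈ Icc (0 : ℝ) 1 := by
  unfold fridman tanhExt
  split_ifs with h
  · simp
  · constructor
    · rw [Real.tanh_eq_sinh_div_cosh]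
      exact div_nonneg (Real.sinh_nonneg_iff.2 ENNReal.toReal_nonneg) (Real.cosh_pos _).le
    · exact (Real.tanh_lt_one _).le

end Fridman

end

/-! If the inequality fails, then along a subsequence `e_{D_j}(z) > c > e_D(z)`. With `R = artanh
c`, the Kobayashi ball of radius `R` about `z` in `D_j` is covered by `f_j(Ω)` with `f_j` injective.
The covering passes to the limit (`exists_injHol_of_exhausts`), so `e_D(z) ≥ c`, a contradiction.

By homogeneity `f_j(a) = z` for a fixed `a`. As `D` is bounded or taut, the `f_j` are locally
bounded and Montel's theorem yields a limit `g` along an ultrafilter. Each point of the `R`-ball of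
`D` has a Euclidean neighbourhood lying in the `R`-balls of almost all `D_j`. Near `z` the inverses
of the `f_j` thus live on a fixed ball and take values in the bounded set `Ω`, so Cauchy's estimate
keeps `g'(a)` invertible. By Osgood's theorem the determinants of the `f_j'` are zero-free, hence by
Hurwitz so is that of `g'`. Therefore `g` is injective, and each `g(p)` lies in some `f_j(Ω) ⊆ D`.

It remains to see that the `R`-ball lies in `g(Ω)`, that is, that preimages of its points do not
escape to the boundary of `Ω`. An automorphism brings the limit of the preimages of `w` back to `a`;
Cauchy's estimate then controls the preimages of all points within a fixed fraction of the radius of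
a covered ball about `w`. So the good points form a relatively open and closed set containing `z`,
and chains of discs connect the ball to `z`. -/

namespace SeveralComplex

open Metric

/-! ### Cauchy estimates and the Weierstrass theorem in normed spaces -/

section Cauchy

variable {E F : Type*} [NormedAddCommGroup E] [NormedSpace ℂ E]
  [NormedAddCommGroup F] [NormedSpace ℂ F]

/-- A Cauchy estimate for the Fréchet derivative. -/
theorem norm_fderiv_le_of_forall_norm_le {f : E → F} {x : E} {r M : ℝ} (hr : 0 < r)
    (hf : DifferentiableOn ℂ f (ball x r)) (hM : ∀ y ∈ ball x r, ‖f y‖ ≤ M) :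
    ‖fderiv ℂ f x‖ ≤ 2 * M / r := by
  refine Complex.norm_fderiv_le_div_of_mapsTo_ball hf (fun y hy => ?_) hr
  rw [mem_closedBall, dist_eq_norm]
  linarith [norm_sub_le (f y) (f x), hM y hy, hM x (mem_ball_self hr)]

theorem norm_fderiv_le_of_mem_ball {f : E → F} {x y : E} {s r M : ℝ} (hr : 0 < r)
    (hf : DifferentiableOn ℂ f (ball x (s + r))) (hM : ∀ y ∈ ball x (s + r), ‖f y‖ ≤ M)
    (hy : y ∈ ball x s) : ‖fderiv ℂ f y‖ ≤ 2 * M / r := by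
  have hsub : ball y r ⊆ ball x (s + r) := by
    refine ball_subset_ball' ?_
    linarith [mem_ball.1 hy]
  exact norm_fderiv_le_of_forall_norm_le hr (hf.mono hsub) fun w hw => hM w (hsub hw)

/-- The Lipschitz constant depends only on `M` and `r`, hence is uniform over families: this gives
equicontinuity in Montel's theorem and the control of preimages. -/
theorem norm_sub_le_of_forall_norm_le {f : E → F} {x y z : E} {s r M : ℝ} (hr : 0 < r)
    (hf : DifferentiableOn ℂ f (ball x (s + r))) (hM : ∀ y ∈ ball x (s + r), ‖f y‖ ≤ M)
    (hy : y ∈ ball x s) (hz : z ∈ ball x s) : ‖f z - f y‖ ≤ 2 * M / r * ‖z - y‖ := by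
  refine (convex_ball x s).norm_image_sub_le_of_norm_fderiv_le (𝕜 := ℂ) (fun w hw => ?_)
    (fun w hw => norm_fderiv_le_of_mem_ball hr hf hM hw) hy hz
  exact hf.differentiableAt (isOpen_ball.mem_nhds (ball_subset_ball (by linarith) hw))

/-- The derivative of a bounded holomorphic map is Lipschitz on smaller balls. -/
theorem norm_fderiv_sub_le_of_forall_norm_le {f : E → F} {x y z : E} {r M : ℝ} (hr : 0 < r)
    (hf : DifferentiableOn ℂ f (ball x (4 * r))) (hM : ∀ y ∈ ball x (4 * r), ‖f y‖ ≤ M)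
    (hy : y ∈ ball x r) (hz : z ∈ ball x r) :
    ‖fderiv ℂ f z - fderiv ℂ f y‖ ≤ 4 * M / r ^ 2 * ‖z - y‖ := by
  have e4 : 4 * r = 3 * r + r := by ring
  have hmap : ∀ w ∈ ball y r, w ∈ ball x (3 * r) ∧ w + (z - y) ∈ ball x (3 * r) := by
    intro w hw
    rw [mem_ball, dist_eq_norm] at hw hy hz
    simp only [mem_ball, dist_eq_norm]
    constructor
    · have : w - x = (w - y) + (y - x) := by abel
      rw [this]; linarith [norm_add_le (w - y) (y - x)]
    · have : w + (z - y) - x = (w - y) + (z - x) := by abel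
      rw [this]; linarith [norm_add_le (w - y) (z - x)]
  have hd : ∀ w ∈ ball x (3 * r), DifferentiableAt ℂ f w := fun w hw =>
    hf.differentiableAt (isOpen_ball.mem_nhds (ball_subset_ball (by linarith) hw))
  have hd' : ∀ w ∈ ball y r, DifferentiableAt ℂ (fun w => f (w + (z - y))) w := fun w hw =>
    (hd _ (hmap w hw).2).comp w (f := fun w => w + (z - y)) (by fun_prop)
  -- Cauchy's estimate for the difference of `f` and its translate, which is already bounded by a
  -- multiple of `‖z - y‖`.
  have key := norm_fderiv_le_of_forall_norm_le (f := fun w => f (w + (z - y)) - f w)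
    (x := y) (r := r) (M := 2 * M / r * ‖z - y‖) hr
    (fun w hw => ((hd' w hw).sub (hd w (hmap w hw).1)).differentiableWithinAt)
    (fun w hw => by
      have := norm_sub_le_of_forall_norm_le (f := f) (x := x) (s := 3 * r) (r := r) (M := M) hr
        (e4 ▸ hf) (e4 ▸ hM) (hmap w hw).1 (hmap w hw).2
      simpa using this)
  have hyy := mem_ball_self (x := y) hr
  rw [fderiv_fun_sub (hd' y hyy) (hd y (hmap y hyy).1), fderiv_comp_add_right] at key
  have e : y + (z - y) = z := by abel
  rw [e] at key
  refine key.trans (le_of_eq ?_)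
  field_simp
  ring

theorem exists_forall_norm_le_ball {f : E → F} {U : Set E} (hU : IsOpen U)
    (hf : DifferentiableOn ℂ f U) {x : E} (hx : x ∈ U) :
    ∃ r > 0, ∃ M, ball x r ⊆ U ∧ ∀ y ∈ ball x r, ‖f y‖ ≤ M := by
  have hc : ContinuousAt f x := (hf.differentiableAt (hU.mem_nhds hx)).continuousAt
  have h1 : ∀ᶠ y in 𝓝 x, ‖f y‖ < ‖f x‖ + 1 :=
    hc.norm.eventually (gt_mem_nhds (by linarith))
  obtain ⟨r, hr, h⟩ := Metric.eventually_nhds_iff_ball.1 (h1.and (hU.mem_nhds hx))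
  exact ⟨r, hr, ‖f x‖ + 1, fun y hy => (h y hy).2, fun y hy => (h y hy).1.le⟩

theorem continuousAt_fderiv {f : E → F} {U : Set E} (hU : IsOpen U)
    (hf : DifferentiableOn ℂ f U) {x : E} (hx : x ∈ U) : ContinuousAt (fderiv ℂ f) x := by
  obtain ⟨r, hr, M, hrU, hM⟩ := exists_forall_norm_le_ball hU hf hx
  have e : 4 * (r / 4) = r := by ring
  have hr4 : 0 < r / 4 := by positivity
  refine continuousAt_of_locally_lipschitz hr4 (4 * M / (r / 4) ^ 2) fun y hy => ?_
  rw [dist_eq_norm, dist_eq_norm]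
  exact norm_fderiv_sub_le_of_forall_norm_le hr4 (by rw [e]; exact hf.mono hrU) (by rwa [e])
    (mem_ball_self hr4) (mem_ball.2 hy)

/-- The regularity required by the inverse function theorem. -/
theorem contDiffAt_one {f : E → F} {U : Set E} (hU : IsOpen U)
    (hf : DifferentiableOn ℂ f U) {x : E} (hx : x ∈ U) : ContDiffAt ℂ 1 f x := by
  have : ContDiffOn ℂ 1 f U := by
    rw [show (1 : WithTop ℕ∞) = 0 + 1 by simp, contDiffOn_succ_iff_fderiv_of_isOpen hU]
    refine ⟨hf, by simp, ?_⟩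
    rw [contDiffOn_zero]
    exact fun y hy => (continuousAt_fderiv hU hf hy).continuousWithinAt
  exact this.contDiffAt (hU.mem_nhds hx)

theorem hasStrictFDerivAt {f : E → F} {U : Set E} (hU : IsOpen U)
    (hf : DifferentiableOn ℂ f U) {x : E} (hx : x ∈ U) :
    HasStrictFDerivAt f (fderiv ℂ f x) x :=
  (contDiffAt_one hU hf hx).hasStrictFDerivAt one_ne_zero

/-- **Weierstrass theorem** on a ball: a uniform limit of holomorphic maps is holomorphic, and the
derivatives converge uniformly on smaller balls. -/
theorem differentiableOn_and_tendstoUniformlyOn_fderiv [CompleteSpace F] {ι : Type*} {l : Filter ι}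
    [NeBot l] {f : ι → E → F} {g : E → F} {x : E} {s r : ℝ} (hr : 0 < r)
    (hf : ∀ᶠ i in l, DifferentiableOn ℂ (f i) (ball x (s + r)))
    (h : TendstoUniformlyOn f g l (ball x (s + r))) :
    DifferentiableOn ℂ g (ball x s) ∧
      TendstoUniformlyOn (fun i => fderiv ℂ (f i)) (fderiv ℂ g) l (ball x s) := by
  have hsub : ball x s ⊆ ball x (s + r) := ball_subset_ball (by linarith)
  have hC : UniformCauchySeqOn (fun i => fderiv ℂ (f i)) l (ball x s) := by
    intro u hu
    obtain ⟨ε, hε, hεu⟩ := Metric.mem_uniformity_dist.1 hu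
    have hδ : 0 < ε * r / 4 := by positivity
    filter_upwards [h.uniformCauchySeqOn _ (Metric.dist_mem_uniformity hδ), hf.prod_mk hf]
      with m hm hm' y hy
    refine hεu ?_
    have hd : ∀ i, DifferentiableOn ℂ (f i) (ball x (s + r)) → DifferentiableAt ℂ (f i) y :=
      fun i hi => hi.differentiableAt (isOpen_ball.mem_nhds (hsub hy))
    have := norm_fderiv_le_of_mem_ball (f := fun w => f m.1 w - f m.2 w) (M := ε * r / 4) hr
      (hm'.1.sub hm'.2) (fun w hw => by
        rw [← dist_eq_norm]; exact (hm w hw).le) hy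
    rw [fderiv_fun_sub (hd _ hm'.1) (hd _ hm'.2)] at this
    rw [dist_eq_norm]
    refine this.trans_lt ?_
    rw [div_lt_iff₀ hr]
    nlinarith [mul_pos hε hr]
  choose! G hG using fun y (hy : y ∈ ball x s) =>
    CompleteSpace.complete (hC.cauchy_map hy)
  have hT : TendstoUniformlyOn (fun i => fderiv ℂ (f i)) G l (ball x s) :=
    hC.tendstoUniformlyOn_of_tendsto hG
  have hder : ∀ y ∈ ball x s, HasFDerivAt g (G y) y := by
    intro y hy
    have hnhds : ball x s ∈ 𝓝 y := isOpen_ball.mem_nhds hy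
    refine hasFDerivAt_of_tendstoUniformlyOnFilter (l := l) (f := f)
      (f' := fun i => fderiv ℂ (f i)) ?_ ?_ ?_
    · exact (tendstoUniformlyOn_iff_tendstoUniformlyOnFilter.1 hT).mono_right
        (le_principal_iff.2 hnhds)
    · filter_upwards [hf.prod_mk hnhds] with p hp
      exact (hp.1.differentiableAt (isOpen_ball.mem_nhds (hsub hp.2))).hasFDerivAt
    · filter_upwards [hnhds] with w hw
      exact h.tendsto_at (hsub hw)
  refine ⟨fun y hy => (hder y hy).differentiableAt.differentiableWithinAt, ?_⟩
  exact hT.congr_right fun y hy => (hder y hy).fderiv.symm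

/-- Directional derivatives of holomorphic maps are holomorphic. -/
theorem differentiableOn_fderiv_apply [CompleteSpace F] {f : E → F} {U : Set E} (hU : IsOpen U)
    (hf : DifferentiableOn ℂ f U) (v : E) : DifferentiableOn ℂ (fun x => fderiv ℂ f x v) U := by
  intro x hx
  refine DifferentiableAt.differentiableWithinAt ?_
  obtain ⟨r', hr', M, hrU, hM⟩ := exists_forall_norm_le_ball hU hf hx
  obtain ⟨r, rfl⟩ : ∃ r, r' = 4 * r := ⟨r' / 4, by ring⟩
  have hr : 0 < r := by linarith
  have hM0 : 0 ≤ M := (norm_nonneg _).trans (hM x (mem_ball_self hr'))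
  have hd : ∀ w ∈ ball x r, DifferentiableAt ℂ f w := fun w hw =>
    hf.differentiableAt (hU.mem_nhds (hrU (ball_subset_ball (by linarith) hw)))
  have hsmall : ∀ᶠ t : ℂ in 𝓝[≠] 0, ‖t • v‖ < r / 2 := by
    have : Tendsto (fun t : ℂ => ‖t • v‖) (𝓝[≠] 0) (𝓝 0) := by
      have h : Continuous fun t : ℂ => ‖t • v‖ := by fun_prop
      simpa using (h.tendsto 0).mono_left nhdsWithin_le_nhds
    exact this.eventually (gt_mem_nhds (by positivity))
  have hmem : ∀ y ∈ ball x (r / 2), ∀ t : ℂ, ‖t • v‖ < r / 2 → y + t • v ∈ ball x r := by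
    intro y hy t ht
    rw [mem_ball, dist_eq_norm] at *
    have : y + t • v - x = (y - x) + t • v := by abel
    rw [this]
    linarith [norm_add_le (y - x) (t • v)]
  have hsub : ball x (r / 2) ⊆ ball x r := ball_subset_ball (by linarith)
  have e : r / 4 + r / 4 = r / 2 := by ring
  -- Difference quotients are holomorphic in `y` and converge uniformly as `t → 0`, so Weierstrass
  -- applies.
  have key := differentiableOn_and_tendstoUniformlyOn_fderiv (l := 𝓝[≠] (0 : ℂ))
    (f := fun t y => t⁻¹ • (f (y + t • v) - f y)) (g := fun y => fderiv ℂ f y v)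
    (x := x) (s := r / 4) (r := r / 4) (by positivity) ?_ ?_
  · exact key.1.differentiableAt (ball_mem_nhds x (by positivity))
  · filter_upwards [hsmall] with t ht
    rw [e]
    intro y hy
    have h1 : DifferentiableAt ℂ (fun y => f (y + t • v)) y :=
      (hd _ (hmem y hy t ht)).comp y (f := fun y => y + t • v) (by fun_prop)
    exact ((h1.sub (hd y (hsub hy))).const_smul t⁻¹).differentiableWithinAt
  · rw [e, Metric.tendstoUniformlyOn_iff]
    intro ε hε
    have hsmall' : ∀ᶠ t : ℂ in 𝓝[≠] 0, 4 * M / r ^ 2 * ‖t • v‖ * ‖v‖ < ε := by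
      have : Tendsto (fun t : ℂ => 4 * M / r ^ 2 * ‖t • v‖ * ‖v‖) (𝓝[≠] 0) (𝓝 0) := by
        have h : Continuous fun t : ℂ => 4 * M / r ^ 2 * ‖t • v‖ * ‖v‖ := by fun_prop
        simpa using (h.tendsto 0).mono_left nhdsWithin_le_nhds
      exact this.eventually (gt_mem_nhds hε)
    filter_upwards [hsmall, hsmall', self_mem_nhdsWithin] with t ht ht' ht0 y hy
    have ht0 : t ≠ 0 := ht0
    have hseg : segment ℝ y (y + t • v) ⊆ ball x r :=
      (convex_ball x r).segment_subset (hsub hy) (hmem y hy t ht)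
    have hmv := (convex_segment (𝕜 := ℝ) y (y + t • v)).norm_image_sub_le_of_norm_fderiv_le'
      (𝕜 := ℂ) (f := f) (φ := fderiv ℂ f y) (C := 4 * M / r ^ 2 * ‖t • v‖)
      (fun w hw => hd w (hseg hw)) (fun w hw => by
        refine (norm_fderiv_sub_le_of_forall_norm_le hr (hf.mono hrU) hM (hsub hy)
          (hseg hw)).trans ?_
        have : ‖w - y‖ ≤ ‖t • v‖ := by
          simpa using norm_sub_le_of_mem_segment hw
        gcongr) (left_mem_segment ℝ _ _) (right_mem_segment ℝ _ _)
    rw [dist_comm, dist_eq_norm]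
    have e1 : t⁻¹ • (f (y + t • v) - f y) - fderiv ℂ f y v =
        t⁻¹ • (f (y + t • v) - f y - fderiv ℂ f y (y + t • v - y)) := by
      rw [add_sub_cancel_left, map_smul, smul_sub _ _ (t • _), smul_smul, inv_mul_cancel₀ ht0,
        one_smul]
    rw [e1, norm_smul, norm_inv]
    refine lt_of_le_of_lt ?_ ht'
    rw [add_sub_cancel_left] at hmv ⊢
    have ht1 : 0 < ‖t‖ := norm_pos_iff.2 ht0
    rw [inv_mul_le_iff₀ ht1]
    refine hmv.trans (le_of_eq ?_)
    rw [norm_smul]; ring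

end Cauchy

/-! ### Zeros and injectivity in one variable -/

section OneVariable

/-- If `g` is smaller at the centre of a disc than on its boundary, it vanishes in the disc. -/
theorem exists_mem_ball_eq_zero {g : ℂ → ℂ} {c : ℂ} {ρ ε : ℝ} (hρ : 0 < ρ)
    (hg : DiffContOnCl ℂ g (ball c ρ)) (hs : ∀ t ∈ sphere c ρ, ε ≤ ‖g t‖) (hc : ‖g c‖ < ε) :
    ∃ t ∈ ball c ρ, g t = 0 := by
  by_contra! hne
  have hε : 0 < ε := (norm_nonneg _).trans_lt hc
  have hne' : ∀ t ∈ closure (ball c ρ), g t ≠ 0 := by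
    rw [closure_ball c hρ.ne', ← ball_union_sphere]
    rintro t (ht | ht)
    · exact hne t ht
    · exact norm_pos_iff.1 (hε.trans_le (hs t ht))
  -- Maximum principle for `1 / g`.
  have h := Complex.norm_le_of_forall_mem_frontier_norm_le isBounded_ball (hg.inv hne')
    (C := ε⁻¹) (fun t ht => by
      rw [frontier_ball c hρ.ne'] at ht
      rw [Pi.inv_apply, norm_inv]
      exact inv_anti₀ hε (hs t ht)) (subset_closure (mem_ball_self hρ))
  rw [Pi.inv_apply, norm_inv] at h
  have hc0 : 0 < ‖g c‖ := norm_pos_iff.2 (hne c (mem_ball_self hρ))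
  exact absurd ((inv_le_inv₀ hc0 hε).1 h) (not_le.2 hc)

/-- An injective holomorphic function of one variable has no critical points. -/
theorem deriv_ne_zero_of_injOn {f : ℂ → ℂ} {U : Set ℂ} (hU : IsOpen U)
    (hf : DifferentiableOn ℂ f U) (hi : InjOn f U) {x : ℂ} (hx : x ∈ U) : deriv f x ≠ 0 := by
  intro h0
  have hUx := hU.mem_nhds hx
  have han : ∀ y ∈ U, AnalyticAt ℂ f y := fun y hy => hf.analyticAt (hU.mem_nhds hy)
  have hnc : ∀ y ∈ U, ¬ ∀ᶠ w in 𝓝 y, f w = f y := by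
    intro y hy hev
    obtain ⟨r, hr, h⟩ := Metric.eventually_nhds_iff_ball.1 (hev.and (hU.mem_nhds hy))
    have hm : y + (r / 2 : ℝ) ∈ ball y r := by
      simp [abs_of_pos hr]; linarith
    have := hi (h _ hm).2 hy (h _ hm).1
    have h3 : ((r / 2 : ℝ) : ℂ) = 0 := by simpa using this
    have h4 : r / 2 = 0 := by exact_mod_cast h3
    linarith
  -- Open mapping theorem; it makes the inverse `g` continuous.
  have hopen : ∀ y ∈ U, 𝓝 (f y) ≤ map f (𝓝 y) := fun y hy =>
    ((han y hy).eventually_constant_or_nhds_le_map_nhds).resolve_left (hnc y hy)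
  set g := Function.invFunOn f U with hg
  have hgf : ∀ y ∈ U, g (f y) = y := fun y hy => hi.leftInvOn_invFunOn hy
  have hgc : ∀ y ∈ U, ContinuousAt g (f y) := by
    intro y hy
    have h1 : Tendsto g (map f (𝓝 y)) (𝓝 y) := by
      rw [tendsto_map'_iff]
      refine tendsto_id.congr' ?_
      filter_upwards [hU.mem_nhds hy] with w hw
      exact (hgf w hw).symm
    rw [ContinuousAt, hgf y hy]
    exact h1.mono_left (hopen y hy)
  have hfg : ∀ y ∈ U, ∀ᶠ w in 𝓝 (f y), g w ∈ U ∧ f (g w) = w := by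
    intro y hy
    refine hopen y hy ?_
    rw [mem_map]
    filter_upwards [hU.mem_nhds hy] with w hw
    simp [hgf w hw, hw]
  have hd : AnalyticAt ℂ (deriv f) x := (han x hx).deriv
  have hnz : ∀ᶠ w in 𝓝[≠] x, deriv f w ≠ 0 := by
    refine hd.eventually_eq_zero_or_eventually_ne_zero.resolve_left fun hz => ?_
    obtain ⟨r, hr, h⟩ := Metric.eventually_nhds_iff_ball.1 (hz.and (hUx))
    refine hnc x hx ?_
    filter_upwards [ball_mem_nhds x hr] with w hw
    refine (convex_ball x r).is_const_of_fderivWithin_eq_zero (𝕜 := ℂ)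
      (hf.mono fun w hw => (h w hw).2) (fun w hw => ?_) hw (mem_ball_self hr)
    rw [fderivWithin_of_isOpen isOpen_ball hw]
    ext
    simp [(h w hw).1]
  have hgx : Tendsto g (𝓝[≠] (f x)) (𝓝[≠] x) := by
    refine tendsto_nhdsWithin_of_tendsto_nhds_of_eventually_within _ ?_ ?_
    · have := hgc x hx
      rw [ContinuousAt, hgf x hx] at this
      exact this.mono_left nhdsWithin_le_nhds
    · filter_upwards [self_mem_nhdsWithin, nhdsWithin_le_nhds (hfg x hx)] with w hw hw' heq
      have heq : g w = x := heq
      exact hw (by rw [← hw'.2, heq]; rfl)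
  have hgd : ∀ᶠ w in 𝓝[≠] (f x), DifferentiableAt ℂ g w := by
    filter_upwards [hgx.eventually hnz, nhdsWithin_le_nhds (hfg x hx)] with w hw hw'
    have hd := (hf.differentiableAt (hU.mem_nhds hw'.1)).hasDerivAt
    refine (HasDerivAt.of_local_left_inverse (f := f) (f' := deriv f (g w)) ?_ hd hw
      ?_).differentiableAt
    · have := hgc (g w) hw'.1
      rwa [hw'.2] at this
    · have := hfg (g w) hw'.1
      rw [hw'.2] at this
      exact this.mono fun _ h => h.2
  -- Critical points are isolated, so `g` is differentiable near `f x` off `f x`, and the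
  -- singularity is removable. The chain rule for `g ∘ f = id` then reads `0 = 1`.
  have hga := Complex.analyticAt_of_differentiable_on_punctured_nhds_of_continuousAt hgd (hgc x hx)
  have hcomp := hga.differentiableAt.hasDerivAt.comp x (hf.differentiableAt hUx).hasDerivAt
  rw [h0, mul_zero] at hcomp
  have hid : HasDerivAt (g ∘ f) 1 x := (hasDerivAt_id x).congr_of_eventuallyEq <| by
    filter_upwards [hUx] with w hw
    exact hgf w hw
  exact zero_ne_one (hcomp.unique hid)

end OneVariable

/-! ### Restriction to complex lines -/

section Slices

variable {E : Type*} [NormedAddCommGroup E] [NormedSpace ℂ E]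

/-- The derivative in the direction `e`. -/
noncomputable def dirDeriv (e : E) (g : E → ℂ) : E → ℂ := fun x => fderiv ℂ g x e

theorem differentiableOn_iterate_dirDeriv {U : Set E} (hU : IsOpen U) {g : E → ℂ}
    (hg : DifferentiableOn ℂ g U) (e : E) (k : ℕ) : DifferentiableOn ℂ ((dirDeriv e)^[k] g) U := by
  induction k with
  | zero => exact hg
  | succ k ih =>
    rw [Function.iterate_succ_apply']
    exact differentiableOn_fderiv_apply hU ih e

theorem hasDerivAt_slice {U : Set E} (hU : IsOpen U) {g : E → ℂ} (hg : DifferentiableOn ℂ g U)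
    (x e : E) {t : ℂ} (ht : x + t • e ∈ U) :
    HasDerivAt (fun t : ℂ => g (x + t • e)) (dirDeriv e g (x + t • e)) t := by
  have h1 : HasDerivAt (fun t : ℂ => x + t • e) e t := by
    simpa using ((hasDerivAt_id t).smul_const e).const_add x
  exact (hg.differentiableAt (hU.mem_nhds ht)).hasFDerivAt.comp_hasDerivAt t h1

theorem isOpen_slice {U : Set E} (hU : IsOpen U) (x e : E) : IsOpen {t : ℂ | x + t • e ∈ U} :=
  hU.preimage (by fun_prop)

theorem differentiableOn_slice {U : Set E} (hU : IsOpen U) {g : E → ℂ}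
    (hg : DifferentiableOn ℂ g U) (x e : E) :
    DifferentiableOn ℂ (fun t : ℂ => g (x + t • e)) {t : ℂ | x + t • e ∈ U} := fun _ ht =>
  (hasDerivAt_slice hU hg x e ht).differentiableAt.differentiableWithinAt

theorem iteratedDeriv_slice {U : Set E} (hU : IsOpen U) {g : E → ℂ} (hg : DifferentiableOn ℂ g U)
    (x e : E) (k : ℕ) : ∀ t : ℂ, x + t • e ∈ U →
      iteratedDeriv k (fun t : ℂ => g (x + t • e)) t = (dirDeriv e)^[k] g (x + t • e) := by
  induction k with
  | zero => simp
  | succ k ih =>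
    intro t ht
    rw [iteratedDeriv_succ, Function.iterate_succ_apply']
    have : iteratedDeriv k (fun t : ℂ => g (x + t • e)) =ᶠ[𝓝 t]
        fun t => (dirDeriv e)^[k] g (x + t • e) := by
      filter_upwards [(isOpen_slice hU x e).mem_nhds ht] with s hs using ih s hs
    rw [this.deriv_eq]
    exact (hasDerivAt_slice hU (differentiableOn_iterate_dirDeriv hU hg e k) x e ht).deriv

/-- If all derivatives at `x` in the direction `e` vanish, then so does `g (x + e)`. -/
theorem eq_zero_of_iterate_dirDeriv_eq_zero {x e : E} {r : ℝ} {g : E → ℂ}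
    (hg : DifferentiableOn ℂ g (ball x r)) (he : ‖e‖ < r)
    (h : ∀ k, (dirDeriv e)^[k] g x = 0) : g (x + e) = 0 := by
  have hr : 0 < r := (norm_nonneg e).trans_lt he
  -- With `R > 1` the Taylor expansion of the slice at `0` is valid at `t = 1`.
  obtain ⟨R, hR1, hR⟩ : ∃ R : ℝ, 1 < R ∧ R * ‖e‖ < r := by
    rcases (norm_nonneg e).eq_or_lt with h0 | h0
    · exact ⟨2, by norm_num, by rw [← h0]; simpa using hr⟩
    · obtain ⟨R, h1, h2⟩ := exists_between ((one_lt_div h0).2 he)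
      exact ⟨R, h1, (lt_div_iff₀ h0).1 h2⟩
  have hsub : ball (0 : ℂ) R ⊆ {t : ℂ | x + t • e ∈ ball x r} := by
    intro t ht
    rw [mem_ball_zero_iff] at ht
    simp only [mem_ofPred_eq, mem_ball, dist_eq_norm, add_sub_cancel_left, norm_smul]
    exact (mul_le_mul_of_nonneg_right ht.le (norm_nonneg e)).trans_lt hR
  have hT := Complex.taylorSeries_eq_on_ball' (c := 0) (r := R) (z := 1) (by simpa using hR1)
    ((differentiableOn_slice isOpen_ball hg x e).mono hsub)
  have h0 : ∀ k, iteratedDeriv k (fun t : ℂ => g (x + t • e)) 0 = 0 := by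
    intro k
    rw [iteratedDeriv_slice isOpen_ball hg x e k 0 (by simpa using hr)]
    simpa using h k
  simpa [h0] using hT.symm

end Slices

/-! ### Injective maps with vanishing derivative on a zero set -/

section Critical

variable {E F : Type*} [NormedAddCommGroup E] [NormedSpace ℂ E]
  [NormedAddCommGroup F] [NormedSpace ℂ F]

theorem eventually_eq_of_fderiv_eq_zero {f : E → F} {U : Set E}
    (hf : DifferentiableOn ℂ f U) {x : E} (hx : U ∈ 𝓝 x)
    (h : ∀ᶠ y in 𝓝 x, fderiv ℂ f y = 0) : ∀ᶠ y in 𝓝 x, f y = f x := by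
  obtain ⟨r, hr, h⟩ := Metric.eventually_nhds_iff_ball.1 (h.and hx)
  filter_upwards [ball_mem_nhds x hr] with w hw
  refine (convex_ball x r).is_const_of_fderivWithin_eq_zero (𝕜 := ℂ)
    (hf.mono fun w hw => (h w hw).2) (fun w hw => ?_) hw (mem_ball_self hr)
  rw [fderivWithin_of_isOpen isOpen_ball hw]
  exact (h w hw).1

theorem not_eventually_eq_of_injOn {X : Type*} [Nontrivial E] {f : E → X} {U : Set E} (hi : InjOn f U) {x : E}
    (hx : U ∈ 𝓝 x) : ¬ ∀ᶠ y in 𝓝 x, f y = f x := by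
  intro h
  have hev : ∀ᶠ y in 𝓝 x, y = x := by
    filter_upwards [h, hx] with y hy hyU
    exact hi hyU (mem_of_mem_nhds hx) hy
  have : NeBot (𝓝[≠] x) := Module.punctured_nhds_neBot ℂ E x
  obtain ⟨y, hy, hne⟩ := ((eventually_nhdsWithin_of_eventually_nhds hev).and
    (self_mem_nhdsWithin (s := {x}ᶜ))).exists
  exact hne hy

/-- A small circle in the direction `e` about `q`, on which `δ` is bounded away from zero. -/
theorem exists_sphere_le_norm {δ : E → ℂ} {U : Set E} (hU : IsOpen U)
    (hδ : DifferentiableOn ℂ δ U) {q : E} (hq : q ∈ U) (e : E) {k : ℕ}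
    (hk : (dirDeriv e)^[k] δ q ≠ 0) {σ : ℝ} (hσ : 0 < σ) :
    ∃ ρ > 0, ρ < σ ∧ (∀ t ∈ closedBall (0 : ℂ) ρ, q + t • e ∈ U) ∧
      ∃ ε > 0, ∀ t ∈ sphere (0 : ℂ) ρ, ε ≤ ‖δ (q + t • e)‖ := by
  have hq' : q + (0 : ℂ) • e ∈ U := by simpa using hq
  have hsl := differentiableOn_slice hU hδ q e
  have hop := isOpen_slice hU q e
  have han : AnalyticAt ℂ (fun t : ℂ => δ (q + t • e)) 0 := hsl.analyticAt (hop.mem_nhds hq')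
  have hnz : ∀ᶠ t : ℂ in 𝓝[≠] 0, δ (q + t • e) ≠ 0 := by
    refine han.eventually_eq_zero_or_eventually_ne_zero.resolve_left fun hz => hk ?_
    have h1 := iteratedDeriv_slice hU hδ q e k 0 hq'
    have h2 : (fun t : ℂ => δ (q + t • e)) =ᶠ[𝓝 0] fun _ => (0 : ℂ) := hz
    rw [h2.iteratedDeriv_eq] at h1
    simpa using h1.symm
  obtain ⟨ρ', hρ', hb⟩ := Metric.eventually_nhds_iff_ball.1
    ((eventually_nhdsWithin_iff.1 hnz).and (hop.mem_nhds hq'))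
  obtain ⟨ρ, hρ, hρlt⟩ := exists_between (lt_min hρ' hσ)
  have hcl : closedBall (0 : ℂ) ρ ⊆ ball 0 ρ' :=
    closedBall_subset_ball (hρlt.trans_le (min_le_left _ _))
  have hsph : ∀ t ∈ sphere (0 : ℂ) ρ, q + t • e ∈ U ∧ δ (q + t • e) ≠ 0 := by
    intro t ht
    have h := hb t (hcl (sphere_subset_closedBall ht))
    exact ⟨h.2, h.1 (ne_of_mem_sphere ht hρ.ne')⟩
  have hcont : ContinuousOn (fun t : ℂ => ‖δ (q + t • e)‖) (sphere 0 ρ) :=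
    (hsl.continuousOn.mono fun t ht => (hsph t ht).1).norm
  obtain ⟨t₀, ht₀, hmin⟩ := (isCompact_sphere (0 : ℂ) ρ).exists_isMinOn
    (NormedSpace.sphere_nonempty.2 hρ.le) hcont
  exact ⟨ρ, hρ, hρlt.trans_le (min_le_right _ _), fun t ht => (hb t (hcl ht)).2, _,
    norm_pos_iff.2 (hsph t₀ ht₀).2, fun t ht => hmin ht⟩

/-- Zeros of a holomorphic function near a point `q` of its zero set, on the lines through
`q + s • v` in a direction `e` in which the function does not vanish identically. -/
theorem eventually_exists_zero {δ : E → ℂ} {U : Set E} (hU : IsOpen U)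
    (hδ : DifferentiableOn ℂ δ U) {q : E} (hq : q ∈ U) (hq0 : δ q = 0) (e v : E) {k : ℕ}
    (hk : (dirDeriv e)^[k] δ q ≠ 0) {σ : ℝ} (hσ : 0 < σ) :
    ∀ᶠ s : ℂ in 𝓝 0, ∃ t ∈ ball (0 : ℂ) σ, q + s • v + t • e ∈ U ∧ δ (q + s • v + t • e) = 0 := by
  obtain ⟨ρ, hρ, hρσ, hcl, ε, hε0, hmin⟩ := exists_sphere_le_norm hU hδ hq e hk hσ
  have hjc : ∀ p : ℂ × ℂ, q + p.1 • v + p.2 • e ∈ U →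
      ContinuousAt (fun p : ℂ × ℂ => δ (q + p.1 • v + p.2 • e)) p := by
    intro p hp
    exact ContinuousAt.comp (g := δ) (f := fun p : ℂ × ℂ => q + p.1 • v + p.2 • e)
      (hδ.differentiableAt (hU.mem_nhds hp)).continuousAt (by fun_prop)
  have hjU : IsOpen {p : ℂ × ℂ | q + p.1 • v + p.2 • e ∈ U} := hU.preimage (by fun_prop)
  have h1 : ∀ᶠ s : ℂ in 𝓝 0, ∀ t ∈ sphere (0 : ℂ) ρ, ε / 2 ≤ ‖δ (q + s • v + t • e)‖ := by
    refine (isCompact_sphere (0 : ℂ) ρ).eventually_forall_of_forall_eventually fun t ht => ?_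
    have hm : q + (0 : ℂ) • v + t • e ∈ U := by simpa using hcl t (sphere_subset_closedBall ht)
    have hlt : ε / 2 < ‖δ (q + (0 : ℂ) • v + t • e)‖ := by
      have : ε ≤ ‖δ (q + t • e)‖ := hmin t ht
      simp only [zero_smul, add_zero]; linarith
    exact ((hjc (0, t) hm).norm.eventually (lt_mem_nhds hlt)).mono fun _ h => h.le
  have h2 : ∀ᶠ s : ℂ in 𝓝 0, ∀ t ∈ closedBall (0 : ℂ) ρ, q + s • v + t • e ∈ U := by
    refine (isCompact_closedBall (0 : ℂ) ρ).eventually_forall_of_forall_eventually fun t ht => ?_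
    have hm : q + (0 : ℂ) • v + t • e ∈ U := by simpa using hcl t ht
    exact hjU.mem_nhds (x := (0, t)) hm
  have h3 : ∀ᶠ s : ℂ in 𝓝 0, ‖δ (q + s • v)‖ < ε / 2 := by
    have hc : ContinuousAt (fun s : ℂ => δ (q + s • v)) 0 :=
      ContinuousAt.comp (g := δ) (f := fun s : ℂ => q + s • v)
        (hδ.differentiableAt (hU.mem_nhds (by simpa using hq))).continuousAt (by fun_prop)
    refine hc.norm.eventually (gt_mem_nhds ?_)
    simp [hq0, hε0]
  filter_upwards [h1, h2, h3] with s hs1 hs2 hs3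
  have hd : DiffContOnCl ℂ (fun t : ℂ => δ (q + s • v + t • e)) (ball 0 ρ) := by
    refine DifferentiableOn.diffContOnCl ?_
    rw [closure_ball _ hρ.ne']
    exact (differentiableOn_slice hU hδ (q + s • v) e).mono hs2
  obtain ⟨t, ht, ht0⟩ := exists_mem_ball_eq_zero hρ hd hs1 (by simpa using hs3)
  exact ⟨t, ball_subset_ball hρσ.le ht,
    hs2 t (ball_subset_closedBall ht), ht0⟩

/-- In dimension at least two, the derivative of an injective holomorphic map does not vanish on
the zero set of a holomorphic function, unless this set is empty. -/
theorem ne_zero_of_fderiv_eq_zero [Nontrivial E] {f : E → F} {δ : E → ℂ} {U : Set E}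
    (hE : ∀ e : E, ∃ v : E, ∀ s t : ℂ, s • v + t • e = 0 → s = 0)
    (hU : IsOpen U) (hf : DifferentiableOn ℂ f U) (hi : InjOn f U) (hδ : DifferentiableOn ℂ δ U)
    (hZ : ∀ x ∈ U, δ x = 0 → fderiv ℂ f x = 0) {x : E} (hx : x ∈ U) : δ x ≠ 0 := by
  intro hx0
  obtain ⟨r, hr, hrU⟩ := Metric.isOpen_iff.1 hU x hx
  obtain ⟨y, hy, hy0⟩ : ∃ y ∈ ball x r, δ y ≠ 0 := by
    by_contra! h
    refine not_eventually_eq_of_injOn hi (hU.mem_nhds hx)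
      (eventually_eq_of_fderiv_eq_zero hf (hU.mem_nhds hx) ?_)
    filter_upwards [ball_mem_nhds x hr] with w hw using hZ w (hrU hw) (h w hw)
  obtain ⟨e, rfl⟩ : ∃ e, y = x + e := ⟨y - x, by abel⟩
  -- The order `k` is chosen minimal over all zeros `q`. Then the derivative `h` of order `m = k -
  -- 1` along `e` vanishes at every zero of `δ`, but its own derivative along `e` at `q` does not:
  -- near `q` the zero set lies in a smooth hypersurface.
  have hex : ∃ k, ∃ q ∈ U, δ q = 0 ∧ (dirDeriv e)^[k] δ q ≠ 0 := by
    by_contra! h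
    exact hy0 (eq_zero_of_iterate_dirDeriv_eq_zero (hδ.mono hrU)
      (by simpa [dist_eq_norm] using hy) fun k => h k x hx hx0)
  classical
  obtain ⟨q, hq, hq0, hqk⟩ := Nat.find_spec hex
  have hmin : ∀ k < Nat.find hex, ∀ q ∈ U, δ q = 0 → (dirDeriv e)^[k] δ q = 0 := by
    intro k hk p hp hp0
    by_contra hne
    exact Nat.find_min hex hk ⟨p, hp, hp0, hne⟩
  obtain ⟨m, hm⟩ : ∃ m, Nat.find hex = m + 1 := by
    refine Nat.exists_eq_succ_of_ne_zero fun h0 => hqk ?_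
    rw [h0]; exact hq0
  rw [hm] at hqk hmin
  set h := (dirDeriv e)^[m] δ with hh
  have hh0 : ∀ p ∈ U, δ p = 0 → h p = 0 := hmin m (Nat.lt_succ_self m)
  have hstr := hasStrictFDerivAt hU (differentiableOn_iterate_dirDeriv hU hδ e m) hq
  rw [← hh] at hstr
  set A := fderiv ℂ h q with hA
  have hβ : A e ≠ 0 := by
    rw [Function.iterate_succ_apply'] at hqk; exact hqk
  obtain ⟨v, hv⟩ := hE e
  have hβ0 : 0 < ‖A e‖ := norm_pos_iff.2 hβ
  set c : ℝ := ‖A e‖ / (2 * (‖e‖ + 1)) with hc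
  have hc0 : 0 < c := by positivity
  have hce : c * ‖e‖ ≤ ‖A e‖ / 2 := by
    rw [hc, div_mul_eq_mul_div, div_le_div_iff₀ (by positivity) (by norm_num)]
    nlinarith [norm_nonneg e]
  have hlo := hstr.isLittleO.def hc0
  rw [nhds_prod_eq] at hlo
  obtain ⟨W, hW, hWest⟩ :=
    (eventually_prod_self_iff (r := fun a b => ‖h a - h b - A (a - b)‖ ≤ c * ‖a - b‖)).1 hlo
  obtain ⟨σ, hσ, hσW⟩ : ∃ σ > 0, ∀ s ∈ ball (0 : ℂ) σ, ∀ t ∈ ball (0 : ℂ) σ,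
      q + s • v + t • e ∈ W := by
    have hcont : ContinuousAt (fun p : ℂ × ℂ => q + p.1 • v + p.2 • e) (0, 0) := by fun_prop
    have : ∀ᶠ p : ℂ × ℂ in 𝓝 (0, 0), q + p.1 • v + p.2 • e ∈ W := by
      refine hcont.eventually_mem ?_
      simpa using hW
    obtain ⟨σ, hσ, hb⟩ := Metric.eventually_nhds_iff_ball.1 this
    refine ⟨σ, hσ, fun s hs t ht => hb (s, t) ?_⟩
    rw [← ball_prod_same]
    exact ⟨hs, ht⟩
  obtain ⟨σ', hσ', hb⟩ := Metric.eventually_nhds_iff_ball.1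
    ((eventually_exists_zero hU hδ hq hq0 e v hqk hσ).and (ball_mem_nhds 0 hσ))
  -- A zero of `δ` on each line parallel to `e`. Nothing is known about the regularity of `τ`; the
  -- Lipschitz bound comes from `h = 0` at both points together with `A e ≠ 0`.
  choose! τ hτ using fun s hs => (hb s hs).1
  set p : ℂ → E := fun s => q + s • v + τ s • e with hp
  have hpW : ∀ s ∈ ball (0 : ℂ) σ', p s ∈ W := fun s hs => hσW s (hb s hs).2 _ (hτ s hs).1
  set C : ℝ := 2 / ‖A e‖ * (‖A v‖ + c * ‖v‖) with hC
  have hlip : ∀ s ∈ ball (0 : ℂ) σ', ∀ s' ∈ ball (0 : ℂ) σ',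
      ‖p s - p s'‖ ≤ (‖v‖ + C * ‖e‖) * ‖s - s'‖ := by
    intro s hs s' hs'
    have hest := hWest _ (hpW s hs) _ (hpW s' hs')
    rw [hh0 _ (hτ s hs).2.1 (hτ s hs).2.2, hh0 _ (hτ s' hs').2.1 (hτ s' hs').2.2] at hest
    have hd : p s - p s' = (s - s') • v + (τ s - τ s') • e := by
      simp only [hp, sub_smul]; abel
    have hn : ‖p s - p s'‖ ≤ ‖s - s'‖ * ‖v‖ + ‖τ s - τ s'‖ * ‖e‖ := by
      rw [hd, ← norm_smul, ← norm_smul]; exact norm_add_le _ _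
    have h1 : ‖τ s - τ s'‖ * ‖A e‖ - ‖s - s'‖ * ‖A v‖ ≤ ‖A (p s - p s')‖ := by
      rw [hd, map_add, map_smul, map_smul, ← norm_smul, ← norm_smul]
      have := norm_sub_norm_le ((τ s - τ s') • A e) (-((s - s') • A v))
      rw [norm_neg, sub_neg_eq_add, add_comm ((τ s - τ s') • A e)] at this
      exact this
    have h2 : ‖A (p s - p s')‖ ≤ c * ‖p s - p s'‖ := by
      rwa [sub_zero, zero_sub, norm_neg] at hest
    have h3 : c * ‖p s - p s'‖ ≤ c * (‖s - s'‖ * ‖v‖) + ‖τ s - τ s'‖ * (‖A e‖ / 2) := by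
      calc c * ‖p s - p s'‖ ≤ c * (‖s - s'‖ * ‖v‖ + ‖τ s - τ s'‖ * ‖e‖) := by gcongr
        _ = c * (‖s - s'‖ * ‖v‖) + ‖τ s - τ s'‖ * (c * ‖e‖) := by ring
        _ ≤ _ := by gcongr
    have h4 : ‖τ s - τ s'‖ ≤ C * ‖s - s'‖ := by
      rw [hC, div_mul_eq_mul_div, div_mul_eq_mul_div, le_div_iff₀ hβ0]
      linarith
    calc ‖p s - p s'‖ ≤ ‖s - s'‖ * ‖v‖ + ‖τ s - τ s'‖ * ‖e‖ := hn
      _ ≤ ‖s - s'‖ * ‖v‖ + C * ‖s - s'‖ * ‖e‖ := by gcongr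
      _ = _ := by ring
  -- The derivative of `f` vanishes on the zero set, so a merely Lipschitz `p` gives `f ∘ p` zero
  -- derivative. Then `f` is constant along `p`, against injectivity.
  have hder : ∀ s ∈ ball (0 : ℂ) σ', HasFDerivAt (fun s => f (p s)) (0 : ℂ →L[ℂ] F) s := by
    intro s hs
    have hO : (fun s' => p s' - p s) =O[𝓝 s] fun s' => s' - s := by
      refine Asymptotics.IsBigO.of_bound (‖v‖ + C * ‖e‖) ?_
      filter_upwards [isOpen_ball.mem_nhds hs] with s' hs' using hlip s' hs' s hs
    have hpc : Tendsto p (𝓝 s) (𝓝 (p s)) := by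
      rw [tendsto_iff_norm_sub_tendsto_zero, ← tendsto_zero_iff_norm_tendsto_zero]
      refine hO.trans_tendsto ?_
      have : Continuous fun s' : ℂ => s' - s := by fun_prop
      simpa using this.tendsto s
    have hfd := (hf.differentiableAt (hU.mem_nhds (hτ s hs).2.1)).hasFDerivAt
    rw [hZ _ (hτ s hs).2.1 (hτ s hs).2.2] at hfd
    rw [hasFDerivAt_iff_isLittleO]
    have h1 := (hfd.isLittleO.comp_tendsto hpc).trans_isBigO hO
    simpa [Function.comp_def] using h1
  have hconst := fun {x y} => (convex_ball (0 : ℂ) σ').is_const_of_fderivWithin_eq_zero (𝕜 := ℂ)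
    (f := fun s => f (p s)) (x := x) (y := y)
    (fun s hs => (hder s hs).differentiableAt.differentiableWithinAt)
    (fun s hs => by rw [fderivWithin_of_isOpen isOpen_ball hs, (hder s hs).fderiv])
  have hs₁ : ((σ' / 2 : ℝ) : ℂ) ∈ ball (0 : ℂ) σ' := by
    rw [mem_ball_zero_iff, Complex.norm_real, Real.norm_eq_abs, abs_of_pos (by positivity)]
    linarith
  have hs₀ : (0 : ℂ) ∈ ball (0 : ℂ) σ' := mem_ball_self hσ'
  have heq := hi (hτ _ hs₁).2.1 (hτ _ hs₀).2.1 (hconst hs₁ hs₀)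
  have := hv ((σ' / 2 : ℝ) : ℂ) (τ ((σ' / 2 : ℝ) : ℂ) - τ 0) (by
    have h1 := sub_eq_zero.2 heq
    rw [← h1, sub_smul, zero_smul]; abel)
  have h4 : σ' / 2 = 0 := by exact_mod_cast this
  linarith

end Critical

open Module

universe u v

/-! ### Osgood's theorem, by induction on the dimension -/

section Osgood

theorem differentiableOn_det {X E : Type*} [NormedAddCommGroup X] [NormedSpace ℂ X]
    [NormedAddCommGroup E] [NormedSpace ℂ E] [FiniteDimensional ℂ E] {G : X → E →L[ℂ] E}
    {U : Set X} (h : ∀ v, DifferentiableOn ℂ (fun x => G x v) U) :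
    DifferentiableOn ℂ (fun x => (G x).det) U := by
  let b := Module.finBasis ℂ E
  have e : (fun x => (G x).det) =
      fun x => ∑ σ : Equiv.Perm (Fin (finrank ℂ E)), (Equiv.Perm.sign σ : ℂ) *
        ∏ i, b.coord (σ i) (G x (b i)) := by
    funext x
    rw [ContinuousLinearMap.det, ← LinearMap.det_toMatrix b, Matrix.det_apply']
    simp [LinearMap.toMatrix_apply]
  rw [e]
  refine DifferentiableOn.fun_sum fun σ _ => DifferentiableOn.const_mul ?_ _
  have hentry : ∀ i, DifferentiableOn ℂ (fun x => b.coord (σ i) (G x (b i))) U := fun i =>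
    (LinearMap.toContinuousLinearMap (b.coord (σ i))).differentiable.comp_differentiableOn (h (b i))
  induction (Finset.univ : Finset (Fin (finrank ℂ E))) using Finset.cons_induction with
  | empty => simp
  | cons i s hi ih => simpa only [Finset.prod_cons] using (hentry i).fun_mul ih

theorem det_eq_zero_iff_not_injective {E : Type*} [NormedAddCommGroup E] [NormedSpace ℂ E]
    [FiniteDimensional ℂ E] (A : E →L[ℂ] E) : A.det = 0 ↔ ¬ Function.Injective A := by
  rw [ContinuousLinearMap.det, LinearMap.det_eq_zero_iff_ker_ne_bot, ne_eq, LinearMap.ker_eq_bot]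
  rfl

variable {E : Type u} {F : Type v} [NormedAddCommGroup E] [NormedSpace ℂ E]
  [FiniteDimensional ℂ E] [NormedAddCommGroup F] [NormedSpace ℂ F] [FiniteDimensional ℂ F]

/-- An injective linear map between spaces of the same finite dimension as an equivalence. -/
theorem exists_continuousLinearEquiv_of_injective (A : E →L[ℂ] F) (hA : Function.Injective A)
    (h : finrank ℂ E = finrank ℂ F) : ∃ e : E ≃L[ℂ] F, (e : E →L[ℂ] F) = A := by
  refine ⟨(LinearMap.linearEquivOfInjective (A : E →ₗ[ℂ] F) hA h).toContinuousLinearEquiv, ?_⟩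
  ext v
  rfl

/-- Restricting an injective holomorphic map to a level set of the part of it that is a submersion
at `x` gives an injective holomorphic map on a neighbourhood of `0` in the kernel of the derivative
at `x`, into a space of the same dimension, with vanishing derivative at `0`. -/
theorem exists_injOn_ker_fderiv_eq_zero (h : finrank ℂ E = finrank ℂ F) {f : E → F} {U : Set E}
    (hU : IsOpen U) (hf : DifferentiableOn ℂ f U) (hi : InjOn f U) {x : E} (hx : x ∈ U) :
    ∃ (G : Submodule ℂ F) (V : Set (fderiv ℂ f x).ker) (φ : (fderiv ℂ f x).ker → G),
      finrank ℂ G = finrank ℂ (fderiv ℂ f x).ker ∧ IsOpen V ∧ 0 ∈ V ∧ DifferentiableOn ℂ φ V ∧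
        InjOn φ V ∧ fderiv ℂ φ 0 = 0 := by
  set A := fderiv ℂ f x with hA
  set K := A.ker with hK
  set R := A.range with hR
  have hrn : finrank ℂ R + finrank ℂ K = finrank ℂ E :=
    LinearMap.finrank_range_add_finrank_ker (A : E →ₗ[ℂ] F)
  obtain ⟨π, hπ⟩ := Submodule.ClosedComplemented.of_finiteDimensional (𝕜 := ℂ) R
  obtain ⟨P, hP⟩ := Submodule.ClosedComplemented.of_finiteDimensional (𝕜 := ℂ) K
  obtain ⟨Q, hQ⟩ := Submodule.ClosedComplemented.of_finiteDimensional (𝕜 := ℂ) π.ker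
  have hfin : finrank ℂ π.ker = finrank ℂ K := by
    have h1 := LinearMap.finrank_range_add_finrank_ker (π : F →ₗ[ℂ] R)
    have h2 : (π : F →ₗ[ℂ] R).range = ⊤ :=
      LinearMap.range_eq_top.2 fun y => ⟨y, hπ y⟩
    rw [h2, finrank_top] at h1
    have : finrank ℂ π.ker = finrank ℂ (π : F →ₗ[ℂ] R).ker := rfl
    omega
  have hfx : DifferentiableAt ℂ f x := hf.differentiableAt (hU.mem_nhds hx)
  -- `π ∘ f` is a submersion at `x` onto the range of `A`, and `P` supplies the coordinates along
  -- the kernel. Inverting `Φ` parametrizes the level set of `π ∘ f` by the kernel.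
  let Φ : E → R × K := fun y => (π (f y), P y)
  let L : E →L[ℂ] R × K := (π.comp A).prod P
  have hL : Function.Injective L := by
    refine (injective_iff_map_eq_zero L).2 fun v hv => ?_
    have hv' : π (A v) = 0 ∧ P v = 0 := Prod.mk.injEq .. ▸ hv
    have hAv : A v = 0 := by
      have := hπ ⟨A v, ⟨v, rfl⟩⟩
      simp only [hv'.1] at this
      exact (congrArg Subtype.val this).symm
    have := hP ⟨v, hAv⟩
    simp only [hv'.2] at this
    exact (congrArg Subtype.val this).symm
  obtain ⟨e, he⟩ := exists_continuousLinearEquiv_of_injective L hL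
    (by rw [finrank_prod]; exact hrn.symm)
  have hΦd : DifferentiableOn ℂ Φ U :=
    (π.differentiable.comp_differentiableOn hf).prodMk P.differentiableOn
  have hΦc : ContDiffAt ℂ 1 Φ x := contDiffAt_one hU hΦd hx
  have hΦx : HasFDerivAt Φ (e : E →L[ℂ] R × K) x := by
    rw [he]
    exact (π.hasFDerivAt.comp x hfx.hasFDerivAt).prodMk P.hasFDerivAt
  have hΦs := hΦc.hasStrictFDerivAt' hΦx one_ne_zero
  let Ψ : R × K → E := hΦs.localInverse Φ e x
  have hΨc : ContDiffAt ℂ 1 Ψ (Φ x) := hΦc.to_localInverse hΦx one_ne_zero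
  have hΨx : Ψ (Φ x) = x := hΦs.localInverse_apply_image
  have hΨe : ∀ᶠ p in 𝓝 (Φ x), DifferentiableAt ℂ Ψ p ∧ Φ (Ψ p) = p ∧ Ψ p ∈ U := by
    refine ((hΨc.eventually (by simp)).mono fun p hp => hp.differentiableAt one_ne_zero).and
      (hΦs.eventually_right_inverse.and ?_)
    exact hΦs.localInverse_tendsto.eventually_mem (hU.mem_nhds hx)
  let ι : K → R × K := fun k => (π (f x), P x + k)
  have hι : Continuous ι := by fun_prop
  have hιd : Differentiable ℂ ι := by fun_prop
  have hι0 : ι 0 = Φ x := by simp [ι, Φ]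
  obtain ⟨V, hV, hVo, hV0⟩ := _root_.eventually_nhds_iff.1
    ((hι.tendsto' 0 (Φ x) hι0).eventually hΨe)
  let ψ : K → E := fun k => Ψ (ι k)
  have hψd : ∀ k ∈ V, DifferentiableAt ℂ ψ k := fun k hk =>
    (hV k hk).1.comp k hιd.differentiableAt
  have hψ0 : ψ 0 = x := by simp only [ψ, hι0, hΨx]
  have hψ : ∀ k ∈ V, π (f (ψ k)) = π (f x) ∧ P (ψ k) = P x + k := fun k hk =>
    Prod.mk.injEq .. ▸ (hV k hk).2.1
  have hker : ∀ k ∈ V, f (ψ k) - f x ∈ π.ker := fun k hk => by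
    rw [LinearMap.mem_ker, ContinuousLinearMap.coe_coe, map_sub, (hψ k hk).1, sub_self]
  refine ⟨π.ker, V, fun k => Q (f (ψ k) - f x), hfin, hVo, hV0, fun k hk => ?_,
    fun k hk k' hk' heq => ?_, ?_⟩
  · refine DifferentiableAt.differentiableWithinAt ?_
    refine Q.differentiableAt.comp k (DifferentiableAt.sub_const ?_ _)
    exact (hf.differentiableAt (hU.mem_nhds (hV k hk).2.2)).comp k (hψd k hk)
  · have h1 := hQ ⟨_, hker k hk⟩
    have h2 := hQ ⟨_, hker k' hk'⟩
    have h3 : f (ψ k) - f x = f (ψ k') - f x :=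
      congrArg Subtype.val (h1.symm.trans (heq.trans h2))
    have h4 : ψ k = ψ k' := hi (hV k hk).2.2 (hV k' hk').2.2 (sub_left_injective h3)
    have h5 := (hψ k hk).2
    rw [h4, (hψ k' hk').2] at h5
    exact (add_left_cancel h5).symm
  · have hfψ : HasFDerivAt (fun k => f (ψ k)) (A.comp (fderiv ℂ ψ 0)) 0 := by
      have hfx' : HasFDerivAt f A (ψ 0) := by rw [hψ0]; exact hfx.hasFDerivAt
      exact hfx'.comp 0 (hψd 0 hV0).hasFDerivAt
    -- `π ∘ f` is constant on the level set; as `π` is the identity on the range of `A`, this forces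
    -- `A ∘ ψ'(0) = 0`.
    have hπ0 : π.comp (A.comp (fderiv ℂ ψ 0)) = 0 := by
      have h1 : HasFDerivAt (fun k => π (f (ψ k))) (π.comp (A.comp (fderiv ℂ ψ 0))) 0 :=
        π.hasFDerivAt.comp 0 hfψ
      refine h1.unique ((hasFDerivAt_const (π (f x)) (0 : K)).congr_of_eventuallyEq ?_)
      filter_upwards [hVo.mem_nhds hV0] with k hk using (hψ k hk).1
    have hA0 : A.comp (fderiv ℂ ψ 0) = 0 := by
      ext k
      have h1 := hπ ⟨A (fderiv ℂ ψ 0 k), ⟨_, rfl⟩⟩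
      have h2 : π (A (fderiv ℂ ψ 0 k)) = 0 := DFunLike.congr_fun hπ0 k
      simp only [h2] at h1
      exact (congrArg Subtype.val h1).symm
    rw [hA0] at hfψ
    have h2 : HasFDerivAt (fun k => Q (f (ψ k) - f x)) (Q.comp (0 : K →L[ℂ] F)) 0 :=
      Q.hasFDerivAt.comp 0 (hfψ.sub_const (f x))
    rw [h2.fderiv, ContinuousLinearMap.comp_zero]

/-- **Osgood's theorem**: the derivative of an injective holomorphic map between spaces of the same
finite dimension is everywhere injective. -/
theorem injective_fderiv_of_injOn (h : finrank ℂ E = finrank ℂ F) {f : E → F} {U : Set E}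
    (hU : IsOpen U) (hf : DifferentiableOn ℂ f U) (hi : InjOn f U) {x : E} (hx : x ∈ U) :
    Function.Injective (fderiv ℂ f x) := by
  induction hn : finrank ℂ E using Nat.strong_induction_on generalizing E F with
  | _ n ih =>
  subst hn
  rcases subsingleton_or_nontrivial E with hE | hE
  · exact Function.injective_of_subsingleton _
  -- If a singular derivative were nonzero, its kernel would have smaller positive dimension and
  -- carry an injective map with zero derivative, against the induction hypothesis.
  have hzero : ∀ y ∈ U, ¬ Function.Injective (fderiv ℂ f y) → fderiv ℂ f y = 0 := by
    intro y hy hni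
    by_contra hne
    obtain ⟨G, V, φ, hfin, hVo, hV0, hφ, hφi, hφ0⟩ := exists_injOn_ker_fderiv_eq_zero h hU hf hi hy
    have hlt : finrank ℂ (fderiv ℂ f y).ker < finrank ℂ E := by
      refine Submodule.finrank_lt fun htop => hne ?_
      ext v
      have : v ∈ (fderiv ℂ f y).ker := htop ▸ Submodule.mem_top
      exact this
    have hinj := ih _ hlt hfin.symm hVo hφ hφi hV0 rfl
    refine hni ((injective_iff_map_eq_zero _).2 fun v hv => ?_)
    have := hinj (a₁ := ⟨v, hv⟩) (a₂ := 0) (by rw [hφ0]; rfl)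
    exact congrArg Subtype.val this
  by_contra hni
  -- In dimension at least two the critical set is the zero set of a determinant and the derivative
  -- vanishes on it; dimension one is classical.
  rcases Nat.lt_or_ge 1 (finrank ℂ E) with h1 | h1
  · let T : F ≃L[ℂ] E := ContinuousLinearEquiv.ofFinrankEq h.symm
    have hiff : ∀ y, ((T : F →L[ℂ] E).comp (fderiv ℂ f y)).det = 0 ↔
        ¬ Function.Injective (fderiv ℂ f y) := by
      intro y
      rw [det_eq_zero_iff_not_injective]
      exact not_congr (T.injective.of_comp_iff _)
    refine ne_zero_of_fderiv_eq_zero (δ := fun y => ((T : F →L[ℂ] E).comp (fderiv ℂ f y)).det)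
      (fun e => ?_) hU hf hi ?_ (fun y hy h0 => hzero y hy ((hiff y).1 h0)) hx ((hiff x).2 hni)
    · rcases eq_or_ne e 0 with rfl | he
      · obtain ⟨v, hv⟩ := exists_ne (0 : E)
        exact ⟨v, fun s t hst => by simpa [hv] using hst⟩
      · obtain ⟨v, hv⟩ := exists_linearIndependent_pair_of_one_lt_finrank (R := ℂ) h1 he
        refine ⟨v, fun s t hst => (LinearIndependent.pair_iff.1 hv t s ?_).2⟩
        rw [add_comm]; exact hst
    · refine differentiableOn_det fun v => ?_
      exact T.differentiable.comp_differentiableOn (differentiableOn_fderiv_apply hU hf v)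
  · have hE1 : finrank ℂ E = 1 := le_antisymm h1 finrank_pos
    let T : F ≃L[ℂ] ℂ := ContinuousLinearEquiv.ofFinrankEq (by rw [← h, hE1, finrank_self])
    obtain ⟨e, he⟩ := exists_ne (0 : E)
    have hd : DifferentiableOn ℂ (fun y => T (f y)) U := T.differentiable.comp_differentiableOn hf
    refine deriv_ne_zero_of_injOn (isOpen_slice hU x e) (differentiableOn_slice hU hd x e)
      (fun s hs t ht hst => ?_) (x := 0) (by simpa using hx) ?_
    · have := hi hs ht (T.injective hst)
      exact smul_left_injective ℂ he (add_left_cancel this)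
    · have hx' : x + (0 : ℂ) • e ∈ U := by simpa using hx
      rw [(hasDerivAt_slice hU hd x e hx').deriv, dirDeriv]
      have h1 : HasFDerivAt (fun y => T (f y)) ((T : F →L[ℂ] ℂ).comp (fderiv ℂ f x)) x :=
        T.hasFDerivAt.comp x (hf.differentiableAt (hU.mem_nhds hx)).hasFDerivAt
      rw [zero_smul, add_zero, h1.fderiv, hzero x hx hni]
      simp

end Osgood

/-! ### Locally uniform convergence -/

section UniformConvergence

variable {E G : Type*} [NormedAddCommGroup E] [NormedAddCommGroup G]
  {ι : Type*} {l : Filter ι} {U : Set E}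

/-- Uniform convergence on a ball about each point of `U`. -/
def TendstoUniformlyOnBalls (f : ι → E → G) (g : E → G) (l : Filter ι) (U : Set E) : Prop :=
  ∀ x ∈ U, ∃ r > 0, ball x r ⊆ U ∧ TendstoUniformlyOn f g l (ball x r)

theorem TendstoUniformlyOnBalls.tendsto_at {f : ι → E → G} {g : E → G}
    (h : TendstoUniformlyOnBalls f g l U) {x : E} (hx : x ∈ U) :
    Tendsto (fun i => f i x) l (𝓝 (g x)) := by
  obtain ⟨r, hr, -, hu⟩ := h x hx
  exact hu.tendsto_at (mem_ball_self hr)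

end UniformConvergence

/-! ### Montel, Hurwitz, and limits of injective maps -/

section Limits

variable {E F : Type*} [NormedAddCommGroup E] [NormedSpace ℂ E]
  [NormedAddCommGroup F] [NormedSpace ℂ F] {ι : Type*} {l : Filter ι} {U : Set E}

theorem TendstoUniformlyOnBalls.differentiableOn [CompleteSpace F] [NeBot l] {f : ι → E → F}
    {g : E → F} (h : TendstoUniformlyOnBalls f g l U) (hf : ∀ i, DifferentiableOn ℂ (f i) U) :
    DifferentiableOn ℂ g U := by
  intro x hx
  obtain ⟨r, hr, hrU, hu⟩ := h x hx
  rw [← add_halves r] at hu hrU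
  have := (differentiableOn_and_tendstoUniformlyOn_fderiv (half_pos hr)
    (Eventually.of_forall fun i => (hf i).mono hrU) hu).1
  exact (this.differentiableAt (ball_mem_nhds x (half_pos hr))).differentiableWithinAt

theorem TendstoUniformlyOnBalls.fderiv [CompleteSpace F] [NeBot l] {f : ι → E → F}
    {g : E → F} (h : TendstoUniformlyOnBalls f g l U) (hf : ∀ i, DifferentiableOn ℂ (f i) U) :
    TendstoUniformlyOnBalls (fun i => fderiv ℂ (f i)) (fderiv ℂ g) l U := by
  intro x hx
  obtain ⟨r, hr, hrU, hu⟩ := h x hx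
  refine ⟨r / 2, half_pos hr, (ball_subset_ball (by linarith)).trans hrU, ?_⟩
  rw [← add_halves r] at hu hrU
  exact (differentiableOn_and_tendstoUniformlyOn_fderiv (half_pos hr)
    (Eventually.of_forall fun i => (hf i).mono hrU) hu).2

/-- **Montel's theorem** along an ultrafilter. -/
theorem exists_tendstoUniformlyOnBalls [ProperSpace E] [ProperSpace F] (𝒰 : Ultrafilter ι)
    {f : ι → E → F} (hf : ∀ i, DifferentiableOn ℂ (f i) U)
    (hb : ∀ x ∈ U, ∃ r > 0, ∃ M, ball x r ⊆ U ∧ ∀ i, ∀ y ∈ ball x r, ‖f i y‖ ≤ M) :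
    ∃ g : E → F, TendstoUniformlyOnBalls f g 𝒰 U := by
  -- Bounded values converge along an ultrafilter, so no diagonal subsequence is needed; the common
  -- Lipschitz constant makes the convergence uniform.
  have hlim : ∀ x ∈ U, ∃ y, Tendsto (fun i => f i x) 𝒰 (𝓝 y) := by
    intro x hx
    obtain ⟨r, hr, M, hrU, hM⟩ := hb x hx
    have hmem : (𝒰.map fun i => f i x : Filter F) ≤ 𝓟 (closedBall 0 M) := by
      refine le_principal_iff.2 (Filter.mem_map.2 (Eventually.of_forall fun i => ?_))
      simpa using hM i x (mem_ball_self hr)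
    obtain ⟨y, -, hy⟩ := (isCompact_closedBall (0 : F) M).ultrafilter_le_nhds _ hmem
    exact ⟨y, hy⟩
  choose! g hg using hlim
  refine ⟨g, fun x hx => ?_⟩
  obtain ⟨r, hr, M, hrU, hM⟩ := hb x hx
  have hM0 : 0 ≤ M := by
    obtain ⟨i⟩ := 𝒰.nonempty_of_mem (univ_mem) |>.to_subtype
    exact (norm_nonneg _).trans (hM i x (mem_ball_self hr))
  have hsub : ball x (r / 2) ⊆ ball x r := ball_subset_ball (by linarith)
  refine ⟨r / 2, half_pos hr, hsub.trans hrU, ?_⟩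
  have hlip : ∀ i, ∀ y ∈ ball x (r / 2), ∀ z ∈ ball x (r / 2),
      ‖f i z - f i y‖ ≤ 2 * M / (r / 2) * ‖z - y‖ := fun i y hy z hz =>
    norm_sub_le_of_forall_norm_le (half_pos hr) (by rw [add_halves]; exact (hf i).mono hrU)
      (by rw [add_halves]; exact hM i) hy hz
  have hlip' : ∀ y ∈ ball x (r / 2), ∀ z ∈ ball x (r / 2),
      ‖g z - g y‖ ≤ 2 * M / (r / 2) * ‖z - y‖ := fun y hy z hz =>
    le_of_tendsto ((hg z (hrU (hsub hz))).sub (hg y (hrU (hsub hy)))).norm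
      (Eventually.of_forall fun i => hlip i y hy z hz)
  set K := 2 * M / (r / 2) with hK
  have hK0 : 0 ≤ K := by positivity
  rw [Metric.tendstoUniformlyOn_iff]
  intro ε hε
  -- A net so fine that the oscillation is below `ε / 3`; `K + 1` allows for `K = 0`.
  obtain ⟨t, htsub, htf, hcov⟩ := exists_finite_cover_balls_of_isCompact_closure
    (s := ball x (r / 2)) (ε := ε / (3 * (K + 1)))
    ((isCompact_closedBall x (r / 2)).of_isClosed_subset isClosed_closure
      closure_ball_subset_closedBall)
    (by positivity)
  have hev : ∀ᶠ i in (𝒰 : Filter ι), ∀ y ∈ t, dist (g y) (f i y) < ε / 3 := by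
    rw [htf.eventually_all]
    intro y hy
    have := hg y (hrU (hsub (htsub hy)))
    filter_upwards [Metric.tendsto_nhds.1 this (ε / 3) (by positivity)] with i hi
    rwa [dist_comm]
  filter_upwards [hev] with i hi z hz
  obtain ⟨y, hy, hzy⟩ := mem_iUnion₂.1 (hcov hz)
  have hyb := htsub hy
  rw [mem_ball, dist_eq_norm] at hzy
  have hKe : K * ‖z - y‖ < ε / 3 := by
    calc K * ‖z - y‖ ≤ (K + 1) * ‖z - y‖ := by gcongr; linarith
      _ < (K + 1) * (ε / (3 * (K + 1))) := by gcongr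
      _ = ε / 3 := by field_simp
  calc dist (g z) (f i z) ≤ dist (g z) (g y) + dist (g y) (f i y) + dist (f i y) (f i z) :=
        dist_triangle4 _ _ _ _
    _ < ε / 3 + ε / 3 + ε / 3 := by
        rw [dist_eq_norm (g z), dist_comm (f i y), dist_eq_norm (f i z)]
        linarith [hlip i y hyb z hz, hlip' y hyb z hz, hi y hy]
    _ = ε := by ring

/-- **Hurwitz's theorem**: on a connected open set, a locally uniform limit of zero-free holomorphic
functions is zero-free unless it vanishes identically. -/
theorem forall_ne_zero_of_tendstoUniformlyOnBalls [NeBot l] {δ : ι → E → ℂ} {δ₀ : E → ℂ}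
    (hU : IsOpen U) (hUc : IsPreconnected U) (hδ : ∀ i, DifferentiableOn ℂ (δ i) U)
    (hne : ∀ i, ∀ x ∈ U, δ i x ≠ 0) (h : TendstoUniformlyOnBalls δ δ₀ l U) {a : E} (ha : a ∈ U)
    (ha0 : δ₀ a ≠ 0) : ∀ x ∈ U, δ₀ x ≠ 0 := by
  have hd := h.differentiableOn hδ
  -- If `δ₀` vanished at `x` but not identically nearby, a small circle on a complex line through
  -- `x` would force a zero of some `δ i`.
  have hopen : ∀ x ∈ U, δ₀ x = 0 → ∀ᶠ y in 𝓝 x, δ₀ y = 0 := by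
    intro x hx hx0
    obtain ⟨r, hr, hrU, hu⟩ := h x hx
    filter_upwards [ball_mem_nhds x hr] with y hy
    by_contra hy0
    obtain ⟨e, rfl⟩ : ∃ e, y = x + e := ⟨y - x, by abel⟩
    have he : ‖e‖ < r := by simpa [dist_eq_norm] using hy
    obtain ⟨k, hk⟩ : ∃ k, (dirDeriv e)^[k] δ₀ x ≠ 0 := by
      by_contra! hall
      exact hy0 (eq_zero_of_iterate_dirDeriv_eq_zero (hd.mono hrU) he hall)
    obtain ⟨ρ, hρ, -, hcl, ε, hε, hmin⟩ := exists_sphere_le_norm isOpen_ball (hd.mono hrU)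
      (mem_ball_self hr) e hk one_pos
    obtain ⟨i, hi⟩ := (Metric.tendstoUniformlyOn_iff.1 hu (ε / 2) (half_pos hε)).exists
    have hdi : DiffContOnCl ℂ (fun t : ℂ => δ i (x + t • e)) (ball 0 ρ) := by
      refine DifferentiableOn.diffContOnCl ?_
      rw [closure_ball _ hρ.ne']
      exact (differentiableOn_slice hU (hδ i) x e).mono fun t ht => hrU (hcl t ht)
    obtain ⟨t, ht, ht0⟩ := exists_mem_ball_eq_zero (ε := ε / 2) hρ hdi (fun t ht => by
      have h1 := hi _ (hcl t (sphere_subset_closedBall ht))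
      rw [dist_eq_norm] at h1
      have h2 := norm_sub_norm_le (δ₀ (x + t • e)) (δ i (x + t • e))
      linarith [hmin t ht]) (by
      have h1 := hi x (mem_ball_self hr)
      rw [hx0, dist_zero_left] at h1
      simpa using h1)
    exact hne i _ (hrU (hcl t (ball_subset_closedBall ht))) ht0
  intro x hx hx0
  have hV : IsOpen {y | y ∈ U ∧ δ₀ y = 0} := isOpen_iff_eventually.2 fun y hy =>
    (hU.eventually_mem hy.1).and (hopen y hy.1 hy.2)
  have hW : IsOpen {y | y ∈ U ∧ δ₀ y ≠ 0} := isOpen_iff_eventually.2 fun y hy =>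
    (hU.eventually_mem hy.1).and
      ((hd.differentiableAt (hU.mem_nhds hy.1)).continuousAt.eventually_ne hy.2)
  obtain ⟨y, -, hy, hy'⟩ := hUc _ _ hV hW
    (fun y hy => (eq_or_ne (δ₀ y) 0).imp (fun h => ⟨hy, h⟩) fun h => ⟨hy, h⟩)
    ⟨x, hx, hx, hx0⟩ ⟨a, ha, ha, ha0⟩
  exact hy'.2 hy.2

/-- If `f i → g` locally uniformly and `g` has invertible derivative at `p`, then `f i` attains the
value `g p` near `p`. -/
theorem eventually_mem_image_ball [FiniteDimensional ℂ E] [NeBot l] {f : ι → E → E} {g : E → E}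
    (hU : IsOpen U) (hf : ∀ i, DifferentiableOn ℂ (f i) U) (h : TendstoUniformlyOnBalls f g l U)
    {p : E} (hp : p ∈ U) (hg : Function.Injective (fderiv ℂ g p)) {ε : ℝ} (hε : 0 < ε) :
    ∀ᶠ i in l, g p ∈ f i '' (ball p ε) := by
  have : CompleteSpace E := FiniteDimensional.complete ℂ E
  rcases subsingleton_or_nontrivial E with hE | hE
  · exact Eventually.of_forall fun i => ⟨p, mem_ball_self hε, Subsingleton.elim _ _⟩
  obtain ⟨A, hA⟩ := exists_continuousLinearEquiv_of_injective _ hg rfl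
  set N := A.toNonlinearRightInverse with hN
  have hNpos : 0 < (N.nnnorm : ℝ) := A.norm_symm_pos
  -- Half the threshold for quantitative surjectivity, so that the covered radius `(N.nnnorm⁻¹ - c)
  -- * η` is positive and independent of `i`.
  set c : NNReal := N.nnnorm⁻¹ / 2 with hc
  have hc0 : (0 : ℝ) < c := by rw [hc]; push_cast; positivity
  obtain ⟨r, hr, hrU, hu⟩ := h.fderiv hf p hp
  obtain ⟨r', hr', hcont⟩ := Metric.eventually_nhds_iff_ball.1
    (Metric.tendsto_nhds.1 (continuousAt_fderiv hU (h.differentiableOn hf) hp) (c / 2)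
      (half_pos hc0))
  obtain ⟨η, hη, hηlt⟩ := exists_between (lt_min hε (lt_min hr hr'))
  have hηε := hηlt.trans_le (min_le_left _ _)
  have hηr := hηlt.trans_le ((min_le_right _ _).trans (min_le_left _ _))
  have hηr' := hηlt.trans_le ((min_le_right _ _).trans (min_le_right _ _))
  have hrad : 0 < ((N.nnnorm : ℝ)⁻¹ - c) * η := by
    have : (c : ℝ) = (N.nnnorm : ℝ)⁻¹ / 2 := by rw [hc]; push_cast; rfl
    rw [this]
    have : 0 < (N.nnnorm : ℝ)⁻¹ := by positivity
    exact mul_pos (by linarith) hη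
  filter_upwards [Metric.tendstoUniformlyOn_iff.1 hu (c / 2) (half_pos hc0),
    Metric.tendsto_nhds.1 (h.tendsto_at hp) _ hrad] with i hi hi'
  have happ : ApproximatesLinearOn (f i) (A : E →L[ℂ] E) (closedBall p η) c := by
    intro x hx y hy
    refine (convex_closedBall p η).norm_image_sub_le_of_norm_fderiv_le' (𝕜 := ℂ)
      (fun w hw => ?_) (fun w hw => ?_) hy hx
    · exact (hf i).differentiableAt (hU.mem_nhds (hrU (closedBall_subset_ball hηr hw)))
    · have h1 := hi w (closedBall_subset_ball hηr hw)
      have h2 := hcont w (closedBall_subset_ball hηr' hw)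
      rw [hA, ← dist_eq_norm]
      rw [dist_comm] at h1
      linarith [dist_triangle (fderiv ℂ (f i) w) (fderiv ℂ g w) (fderiv ℂ g p)]
  obtain ⟨x, hx, hxe⟩ := happ.surjOn_closedBall_of_nonlinearRightInverse N hη.le Subset.rfl
    (show g p ∈ closedBall (f i p) _ by rw [mem_closedBall, dist_comm]; exact hi'.le)
  exact ⟨x, closedBall_subset_ball hηε hx, hxe⟩

/-- A locally uniform limit `g` of injective holomorphic maps on a connected open set is injective
as soon as its derivative is invertible at one point, and then `g p` lies in the image of the
approximating maps. -/
theorem injOn_of_tendstoUniformlyOnBalls [FiniteDimensional ℂ E] [NeBot l] {f : ι → E → E}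
    {g : E → E} (hU : IsOpen U) (hUc : IsPreconnected U) (hf : ∀ i, DifferentiableOn ℂ (f i) U)
    (hi : ∀ i, InjOn (f i) U) (h : TendstoUniformlyOnBalls f g l U) {a : E} (ha : a ∈ U)
    (hga : Function.Injective (fderiv ℂ g a)) :
    InjOn g U ∧ ∀ p ∈ U, ∀ᶠ i in l, g p ∈ f i '' U := by
  have : ProperSpace (E →L[ℂ] E) := FiniteDimensional.proper ℂ _
  have : CompleteSpace E := FiniteDimensional.complete ℂ E
  have hdet : TendstoUniformlyOnBalls (fun i x => (fderiv ℂ (f i) x).det)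
      (fun x => (fderiv ℂ g x).det) l U := by
    intro x hx
    obtain ⟨r, hr, hrU, hu⟩ := h.fderiv hf x hx
    have hc := continuousAt_fderiv hU (h.differentiableOn hf) hx
    obtain ⟨r', hr', hb⟩ := Metric.eventually_nhds_iff_ball.1
      (hc.norm.eventually (gt_mem_nhds (lt_add_one ‖fderiv ℂ g x‖)))
    refine ⟨min r r', lt_min hr hr', (ball_subset_ball (min_le_left _ _)).trans hrU, ?_⟩
    have hu' := hu.mono (ball_subset_ball (min_le_left r r'))
    -- One unit of the radius absorbs the variation of `fderiv ℂ g` near `x`, the other the distance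
    -- from `fderiv ℂ (f i)`.
    have huc : UniformContinuousOn (fun A : E →L[ℂ] E => A.det)
        (closedBall 0 (‖fderiv ℂ g x‖ + 2)) :=
      (isCompact_closedBall _ _).uniformContinuousOn_of_continuous
        ContinuousLinearMap.continuous_det.continuousOn
    refine UniformContinuousOn.comp_tendstoUniformlyOn_eventually ?_ (fun y hy => ?_) huc hu'
    · filter_upwards [Metric.tendstoUniformlyOn_iff.1 hu' 1 one_pos] with i hi y hy
      have h1 := hi y hy
      have h2 := hb y (ball_subset_ball (min_le_right _ _) hy)
      rw [dist_comm, dist_eq_norm] at h1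
      rw [mem_closedBall_zero_iff]
      linarith [norm_sub_norm_le (fderiv ℂ (f i) y) (fderiv ℂ g y)]
    · have h2 := hb y (ball_subset_ball (min_le_right _ _) hy)
      rw [mem_closedBall_zero_iff]
      linarith
  have hinv : ∀ p ∈ U, Function.Injective (fderiv ℂ g p) := by
    intro p hp
    have := forall_ne_zero_of_tendstoUniformlyOnBalls hU hUc
      (fun i => differentiableOn_det (differentiableOn_fderiv_apply hU (hf i)))
      (fun i x hx h0 => (det_eq_zero_iff_not_injective _).1 h0
        (injective_fderiv_of_injOn rfl hU (hf i) (hi i) hx)) hdet ha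
      (fun h0 => (det_eq_zero_iff_not_injective _).1 h0 hga) p hp
    by_contra hni
    exact this ((det_eq_zero_iff_not_injective _).2 hni)
  refine ⟨fun p hp q hq hpq => ?_, fun p hp => ?_⟩
  · by_contra hne
    -- Balls of at most half the distance are disjoint, yet both would contain a preimage of the
    -- common value under the injective `f i`.
    have hpos : 0 < dist p q / 2 := half_pos (dist_pos.2 hne)
    obtain ⟨ε₁, hε₁, hb₁⟩ := Metric.isOpen_iff.1 hU p hp
    obtain ⟨ε₂, hε₂, hb₂⟩ := Metric.isOpen_iff.1 hU q hq
    obtain ⟨i, ⟨x, hx, hxe⟩, ⟨y, hy, hye⟩⟩ :=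
      ((eventually_mem_image_ball hU hf h hp (hinv p hp) (lt_min hpos hε₁)).and
        (eventually_mem_image_ball hU hf h hq (hinv q hq) (lt_min hpos hε₂))).exists
    have hxy := hi i (hb₁ (ball_subset_ball (min_le_right _ _) hx))
      (hb₂ (ball_subset_ball (min_le_right _ _) hy)) (hxe.trans (hpq.trans hye.symm))
    subst hxy
    have h1 := mem_ball.1 (ball_subset_ball (min_le_left _ _) hx)
    have h2 := mem_ball.1 (ball_subset_ball (min_le_left _ _) hy)
    linarith [dist_triangle_left p q x]
  · obtain ⟨ε, hε, hb⟩ := Metric.isOpen_iff.1 hU p hp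
    exact (eventually_mem_image_ball hU hf h hp (hinv p hp) hε).mono fun i hi =>
      image_mono hb hi

end Limits

/-! ### Holomorphic inverses -/

section Inverse

variable {E F : Type*} [NormedAddCommGroup E] [NormedSpace ℂ E] [FiniteDimensional ℂ E]
  [NormedAddCommGroup F] [NormedSpace ℂ F] [FiniteDimensional ℂ F]

/-- The inverse of an injective holomorphic map is holomorphic. -/
theorem differentiableAt_of_leftInvOn (h : finrank ℂ E = finrank ℂ F) {f : E → F} {g : F → E}
    {U : Set E} (hU : IsOpen U) (hf : DifferentiableOn ℂ f U) (hg : LeftInvOn g f U) {x : E}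
    (hx : x ∈ U) : DifferentiableAt ℂ g (f x) := by
  have : CompleteSpace E := FiniteDimensional.complete ℂ E
  have hs := hasStrictFDerivAt hU hf hx
  obtain ⟨A, hA⟩ := exists_continuousLinearEquiv_of_injective _
    (injective_fderiv_of_injOn h hU hf hg.injOn hx) h
  rw [← hA] at hs
  refine (hs.to_local_left_inverse ?_).hasFDerivAt.differentiableAt
  filter_upwards [hU.mem_nhds hx] with y hy using hg hy

theorem differentiableOn_of_leftInvOn (h : finrank ℂ E = finrank ℂ F) {f : E → F} {g : F → E}
    {U : Set E} (hU : IsOpen U) (hf : DifferentiableOn ℂ f U) (hg : LeftInvOn g f U) :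
    DifferentiableOn ℂ g (f '' U) := by
  rintro _ ⟨x, hx, rfl⟩
  exact (differentiableAt_of_leftInvOn h hU hf hg hx).differentiableWithinAt

/-- A lower bound for the derivative of an injective holomorphic map on a bounded set whose image
contains a ball. -/
theorem norm_le_mul_norm_fderiv (h : finrank ℂ E = finrank ℂ F) {f : E → F} {U : Set E}
    (hU : IsOpen U) (hf : DifferentiableOn ℂ f U) (hi : InjOn f U) {M ε : ℝ} (hε : 0 < ε)
    (hM : ∀ x ∈ U, ‖x‖ ≤ M) {a : E} (ha : a ∈ U) (hb : ball (f a) ε ⊆ f '' U) (v : E) :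
    ‖v‖ ≤ 2 * M / ε * ‖fderiv ℂ f a v‖ := by
  have : Nonempty E := ⟨0⟩
  set g := Function.invFunOn f U with hg
  have hgl : LeftInvOn g f U := hi.leftInvOn_invFunOn
  have hgd := differentiableOn_of_leftInvOn h hU hf hgl
  have hbound := norm_fderiv_le_of_forall_norm_le hε (hgd.mono hb) (M := M) (by
    intro y hy
    obtain ⟨x, hx, rfl⟩ := hb hy
    rw [hgl hx]
    exact hM x hx)
  have hcomp : HasFDerivAt (g ∘ f) ((fderiv ℂ g (f a)).comp (fderiv ℂ f a)) a :=
    (differentiableAt_of_leftInvOn h hU hf hgl ha).hasFDerivAt.comp a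
      (hf.differentiableAt (hU.mem_nhds ha)).hasFDerivAt
  have hid : HasFDerivAt (g ∘ f) (ContinuousLinearMap.id ℂ E) a :=
    (hasFDerivAt_id a).congr_of_eventuallyEq <| by
      filter_upwards [hU.mem_nhds ha] with y hy using hgl hy
  have hv : fderiv ℂ g (f a) (fderiv ℂ f a v) = v := DFunLike.congr_fun (hcomp.unique hid) v
  calc ‖v‖ = ‖fderiv ℂ g (f a) (fderiv ℂ f a v)‖ := by rw [hv]
    _ ≤ ‖fderiv ℂ g (f a)‖ * ‖fderiv ℂ f a v‖ := ContinuousLinearMap.le_opNorm _ _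
    _ ≤ _ := by gcongr

end Inverse

end SeveralComplex

namespace Fridman

open Metric

/-! ### Kobayashi distance, chains and exhaustions -/

section Kobayashi

variable {n : ℕ}

theorem norm_moebius_lt_one {a ζ : ℂ} (ha : ‖a‖ < 1) (hζ : ‖ζ‖ < 1) :
    1 + (starRingEnd ℂ) a * ζ ≠ 0 ∧ ‖(ζ + a) / (1 + (starRingEnd ℂ) a * ζ)‖ < 1 := by
  have hne : 1 + (starRingEnd ℂ) a * ζ ≠ 0 := by
    intro h
    have h1 : (starRingEnd ℂ) a * ζ = -1 := by linear_combination h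
    have h2 : ‖a‖ * ‖ζ‖ = 1 := by
      rw [← Complex.norm_conj a, ← norm_mul, h1]; simp
    nlinarith [norm_nonneg a, norm_nonneg ζ]
  refine ⟨hne, ?_⟩
  rw [norm_div, div_lt_one (norm_pos_iff.2 hne)]
  refine lt_of_pow_lt_pow_left₀ 2 (norm_nonneg _) ?_
  have ha' : Complex.normSq a < 1 := by
    rw [Complex.normSq_eq_norm_sq]; nlinarith [norm_nonneg a]
  have hζ' : Complex.normSq ζ < 1 := by
    rw [Complex.normSq_eq_norm_sq]; nlinarith [norm_nonneg ζ]
  rw [← Complex.normSq_eq_norm_sq, ← Complex.normSq_eq_norm_sq]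
  have key : Complex.normSq (1 + (starRingEnd ℂ) a * ζ) - Complex.normSq (ζ + a) =
      (1 - Complex.normSq a) * (1 - Complex.normSq ζ) := by
    simp only [Complex.normSq_apply, Complex.add_re, Complex.add_im, Complex.mul_re,
      Complex.mul_im, Complex.conj_re, Complex.conj_im, Complex.one_re, Complex.one_im]
    ring
  nlinarith [mul_pos (sub_pos.2 ha') (sub_pos.2 hζ')]

/-- Precomposing with the Möbius map that sends `0` to `a` moves the first base point to the centre.
-/
theorem exists_isHolDisc_of_lempert_lt {D : Set (Cn n)} {z w : Cn n} {t : ℝ≥0∞}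
    (h : lempert D z w < t) : ∃ φ : ℂ → Cn n, IsHolDisc D φ ∧ ∃ b ∈ disc, φ 0 = z ∧ φ b = w ∧
      ENNReal.ofReal (Real.artanh ‖b‖) < t := by
  obtain ⟨_, ⟨φ, hφ, a, ha, b, hb, rfl, rfl, rfl⟩, hlt⟩ := sInf_lt_iff.1 h
  rw [mem_ball_zero_iff] at ha hb
  have hm := fun ζ (hζ : ζ ∈ disc) => norm_moebius_lt_one ha (mem_ball_zero_iff.1 hζ)
  have hb' := norm_moebius_lt_one (a := -a) (by rwa [norm_neg]) hb
  simp only [map_neg, neg_mul, ← sub_eq_add_neg] at hb'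
  have hmb : ((b - a) / (1 - (starRingEnd ℂ) a * b) + a) /
      (1 + (starRingEnd ℂ) a * ((b - a) / (1 - (starRingEnd ℂ) a * b))) = b := by
    have h1 := hb'.1
    have h2 := (hm _ (mem_ball_zero_iff.2 hb'.2)).1
    rw [div_eq_iff h2]
    have h3 : 1 - b * (starRingEnd ℂ) a ≠ 0 := by rwa [mul_comm]
    field_simp
    ring
  refine ⟨fun ζ => φ ((ζ + a) / (1 + (starRingEnd ℂ) a * ζ)), ⟨?_, ?_⟩,
    (b - a) / (1 - (starRingEnd ℂ) a * b), mem_ball_zero_iff.2 hb'.2, by simp, ?_, ?_⟩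
  · refine hφ.1.comp (t := disc) ?_ fun ζ hζ => mem_ball_zero_iff.2 (hm ζ hζ).2
    exact DifferentiableOn.div (by fun_prop) (by fun_prop) fun ζ hζ => (hm ζ hζ).1
  · exact fun ζ hζ => hφ.2 (mem_ball_zero_iff.2 (hm ζ hζ).2)
  · simp only [hmb]
  · convert! hlt using 3
    rw [poincareDist, norm_div, norm_div, norm_sub_rev,
      ← Complex.norm_conj (1 - (starRingEnd ℂ) a * b)]
    simp [mul_comm]

theorem lempert_le_of_isHolDisc {D : Set (Cn n)} {φ : ℂ → Cn n} (hφ : IsHolDisc D φ) {b : ℂ}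
    (hb : b ∈ disc) : lempert D (φ 0) (φ b) ≤ ENNReal.ofReal (Real.artanh ‖b‖) :=
  sInf_le ⟨φ, hφ, 0, by simp, b, hb, rfl, rfl, by simp [poincareDist]⟩

theorem kobayashi_le_add_lempert (D : Set (Cn n)) (z w w' : Cn n) :
    kobayashi D z w' ≤ kobayashi D z w + lempert D w w' := by
  conv_rhs => rw [kobayashi]
  rw [ENNReal.sInf_add]
  refine le_iInf₂ fun t ht => ?_
  obtain ⟨m, p, rfl, rfl, rfl⟩ := ht
  refine sInf_le ⟨m + 1, fun i => if i ≤ m + 1 then p i else w', by simp, by simp, ?_⟩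
  rw [Finset.sum_range_succ _ (m + 1)]
  congr 1
  · refine Finset.sum_congr rfl fun i hi => ?_
    rw [Finset.mem_range] at hi
    simp only [if_pos (show i ≤ m + 1 by omega), if_pos (show i + 1 ≤ m + 1 by omega)]
  · simp

theorem lempert_self {D : Set (Cn n)} {z : Cn n} (hz : z ∈ D) : lempert D z z = 0 := by
  have := lempert_le_of_isHolDisc (D := D) (φ := fun _ => z) (b := 0)
    ⟨differentiableOn_const _, fun _ _ => hz⟩ (by simp)
  simpa using this

theorem kobayashi_self {D : Set (Cn n)} {z : Cn n} (hz : z ∈ D) : kobayashi D z z = 0 := by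
  refine le_antisymm (sInf_le ⟨0, fun _ => z, rfl, rfl, ?_⟩) zero_le
  simp [lempert_self hz]

/-- Induction along chains of holomorphic discs. -/
theorem kobayashi_induction {D : Set (Cn n)} {z : Cn n} {P : ℝ≥0∞ → Cn n → Prop}
    (mono : ∀ T T' w, T ≤ T' → P T w → P T' w) (base : ∀ T, 0 < T → P T z)
    (step : ∀ T u φ b, IsHolDisc D φ → b ∈ disc → P T (φ 0) →
      ENNReal.ofReal (Real.artanh ‖b‖) < u → P (T + u) (φ b))
    {w : Cn n} {T : ℝ≥0∞} (h : kobayashi D z w < T) : P T w := by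
  obtain ⟨_, ⟨m, p, rfl, rfl, rfl⟩, hlt⟩ := sInf_lt_iff.1 h
  suffices H : ∀ k T, ∑ i ∈ Finset.range k, lempert D (p i) (p (i + 1)) < T → P T (p k) from
    H _ _ hlt
  intro k
  induction k with
  | zero => intro T hT; exact base T (by simpa using hT)
  | succ k ih =>
    intro T hT
    rw [Finset.sum_range_succ] at hT
    set s := ∑ i ∈ Finset.range k, lempert D (p i) (p (i + 1)) with hs
    obtain ⟨r, hr, hrT⟩ := ENNReal.lt_iff_exists_add_pos_lt.1 hT
    have hfin : s + lempert D (p k) (p (k + 1)) ≠ ⊤ := ne_top_of_lt hT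
    rw [ENNReal.add_ne_top] at hfin
    have hr2 : (r / 2 : ℝ≥0∞) ≠ 0 := by simpa using hr.ne'
    -- The slack `r` is shared equally by the chain so far and the new link.
    obtain ⟨φ, hφ, b, hb, h0, h1, hlt⟩ :=
      exists_isHolDisc_of_lempert_lt (ENNReal.lt_add_right hfin.2 hr2)
    have := step _ _ φ b hφ hb (h0 ▸ ih _ (ENNReal.lt_add_right hfin.1 hr2)) hlt
    rw [h1] at this
    refine mono _ _ _ (le_trans (le_of_eq ?_) hrT.le) this
    rw [add_add_add_comm, ENNReal.add_halves]

theorem exists_lt_artanh_lt {x : ℝ} (hx : 0 ≤ x) (hx1 : x < 1) {u : ℝ≥0∞}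
    (h : ENNReal.ofReal (Real.artanh x) < u) :
    ∃ y, x < y ∧ y < 1 ∧ ENNReal.ofReal (Real.artanh y) < u := by
  obtain ⟨r, hr, h1, h2⟩ := ENNReal.lt_iff_exists_real_btwn.1 h
  refine ⟨Real.tanh r, ?_, Real.tanh_lt_one r, by rwa [Real.artanh_tanh]⟩
  have h3 : Real.artanh x < r := (ENNReal.ofReal_lt_ofReal_iff'.1 h1).1
  rw [← Real.artanh_tanh r] at h3
  exact (Real.artanh_lt_artanh_iff ⟨by linarith, hx1⟩
    ⟨Real.neg_one_lt_tanh r, Real.tanh_lt_one r⟩).1 h3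

theorem Exhausts.eventually_subset {Dj : ℕ → Set (Cn n)} {D : Set (Cn n)} (h : Exhausts Dj D)
    {K : Set (Cn n)} (hK : IsCompact K) (hKD : K ⊆ D) : ∀ᶠ j in atTop, K ⊆ Dj j := by
  obtain ⟨N, hN⟩ := h.2 K hK hKD
  filter_upwards [eventually_gt_atTop N] with j hj using hN j hj

/-- A disc in `D` need not lie in any `D_j`, but the image of a closed disc of radius `ρ < 1` is
compact and eventually does. Rescaling replaces `b` by `b / ρ`, at arbitrarily small cost. -/
theorem eventually_lempert_lt {Dj : ℕ → Set (Cn n)} {D : Set (Cn n)} (h : Exhausts Dj D)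
    {φ : ℂ → Cn n} (hφ : IsHolDisc D φ) {b : ℂ} (hb : b ∈ disc) {u : ℝ≥0∞}
    (hu : ENNReal.ofReal (Real.artanh ‖b‖) < u) :
    ∀ᶠ j in atTop, lempert (Dj j) (φ 0) (φ b) < u := by
  rw [mem_ball_zero_iff] at hb
  obtain ⟨y, hby, hy1, hyu⟩ := exists_lt_artanh_lt (norm_nonneg b) hb hu
  have hy0 : 0 < y := (norm_nonneg b).trans_lt hby
  obtain ⟨ρ, hρl, hρ1⟩ := exists_between ((div_lt_one hy0).2 hby)
  have hρ0 : 0 < ρ := lt_of_le_of_lt (by positivity) hρl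
  have hbρ : ‖b / ρ‖ < y := by
    rw [norm_div, Complex.norm_real, Real.norm_eq_abs, abs_of_pos hρ0, div_lt_iff₀ hρ0]
    rw [div_lt_iff₀ hy0] at hρl
    linarith
  have hsub : closedBall (0 : ℂ) ρ ⊆ disc := closedBall_subset_ball hρ1
  have hK : IsCompact (φ '' closedBall 0 ρ) :=
    (isCompact_closedBall _ _).image_of_continuousOn (hφ.1.continuousOn.mono hsub)
  have hmem : ∀ ζ ∈ disc, (ρ : ℂ) * ζ ∈ closedBall (0 : ℂ) ρ := by
    intro ζ hζ
    rw [mem_ball_zero_iff] at hζ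
    rw [mem_closedBall_zero_iff, norm_mul, Complex.norm_real, Real.norm_eq_abs, abs_of_pos hρ0]
    nlinarith
  filter_upwards [h.eventually_subset hK (hφ.2.mono_left hsub).image_subset] with j hj
  have hdisc : IsHolDisc (Dj j) (fun ζ => φ (ρ * ζ)) := by
    refine ⟨hφ.1.comp (t := disc) (by fun_prop) fun ζ hζ => hsub (hmem ζ hζ), fun ζ hζ => ?_⟩
    exact hj (mem_image_of_mem _ (hmem ζ hζ))
  have hle := lempert_le_of_isHolDisc hdisc (b := b / ρ)
    (mem_ball_zero_iff.2 (hbρ.trans hy1))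
  have hne : (ρ : ℂ) ≠ 0 := by exact_mod_cast hρ0.ne'
  simp only [mul_zero, mul_div_cancel₀ b hne] at hle
  refine hle.trans_lt (lt_of_le_of_lt (ENNReal.ofReal_le_ofReal ?_) hyu)
  exact Real.artanh_le_artanh (by linarith [norm_nonneg (b / ρ)]) hy1 hbρ.le

theorem lempert_le_of_ball_subset {D : Set (Cn n)} {w w' : Cn n} {δ : ℝ}
    (hD : ball w δ ⊆ D) (hw : w' ∈ ball w δ) :
    lempert D w w' ≤ ENNReal.ofReal (Real.artanh (‖w' - w‖ / δ)) := by
  have hδ : 0 < δ := pos_of_mem_ball hw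
  rw [mem_ball, dist_eq_norm] at hw
  -- For `w' = w` the quotient is `0` by convention, and the disc is constant.
  set v : Cn n := ((δ / ‖w' - w‖ : ℝ) : ℂ) • (w' - w) with hv
  have hnv : ‖v‖ ≤ δ := by
    rw [hv, norm_smul, Complex.norm_real, Real.norm_eq_abs, abs_of_nonneg (by positivity)]
    rcases eq_or_ne ‖w' - w‖ 0 with h0 | h0
    · rw [h0]; simpa using hδ.le
    · rw [div_mul_cancel₀ _ h0]
  have hdisc : IsHolDisc D fun ζ => w + ζ • v := by
    refine ⟨by fun_prop, fun ζ hζ => hD ?_⟩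
    rw [mem_ball_zero_iff] at hζ
    rw [mem_ball, dist_eq_norm, add_sub_cancel_left, norm_smul]
    nlinarith [norm_nonneg ζ, norm_nonneg v]
  have hb : ‖(((‖w' - w‖ / δ : ℝ)) : ℂ)‖ = ‖w' - w‖ / δ := by
    rw [Complex.norm_real, Real.norm_eq_abs, abs_of_nonneg (by positivity)]
  have hle := lempert_le_of_isHolDisc hdisc (b := ((‖w' - w‖ / δ : ℝ) : ℂ))
    (mem_ball_zero_iff.2 (by rw [hb]; exact (div_lt_one hδ).2 hw))
  rw [hb] at hle
  convert! hle using 2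
  · simp
  · rw [hv, smul_smul, ← Complex.ofReal_mul]
    rcases eq_or_ne w' w with rfl | hne
    · simp
    · have : ‖w' - w‖ ≠ 0 := norm_ne_zero_iff.2 (sub_ne_zero.2 hne)
      rw [show ‖w' - w‖ / δ * (δ / ‖w' - w‖) = 1 by field_simp]
      simp

/-- Kobayashi balls of an exhausting sequence eventually contain a Euclidean ball about each point
of the corresponding Kobayashi ball of the limit domain. -/
theorem eventually_ball_subset_kobayashiBall {Dj : ℕ → Set (Cn n)} {D : Set (Cn n)}
    (hD : IsOpen D) (h : Exhausts Dj D) {z w : Cn n} (hz : z ∈ D) {R : ℝ}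
    (hw : w ∈ kobayashiBall D z R) :
    ∃ ρ > 0, ∀ᶠ j in atTop, ball w ρ ⊆ kobayashiBall (Dj j) z R := by
  obtain ⟨T, hT, hTR⟩ := exists_between hw.2
  have h1 : ∀ᶠ j in atTop, kobayashi (Dj j) z w < T := by
    refine kobayashi_induction (P := fun T w => ∀ᶠ j in atTop, kobayashi (Dj j) z w < T)
      (fun T T' w hTT h => h.mono fun j hj => hj.trans_le hTT) (fun T hT => ?_)
      (fun T u φ b hφ hb hP hu => ?_) hT
    · filter_upwards [h.eventually_subset isCompact_singleton (singleton_subset_iff.2 hz)] with j hj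
      rw [kobayashi_self (singleton_subset_iff.1 hj)]
      exact hT
    · filter_upwards [hP, eventually_lempert_lt h hφ hb hu] with j hj hj'
      exact (kobayashi_le_add_lempert _ _ _ _).trans_lt (ENNReal.add_lt_add hj hj')
  obtain ⟨r, hr, hrR⟩ := ENNReal.lt_iff_exists_add_pos_lt.1 hTR
  obtain ⟨y, hy0, hy1, hyr⟩ := exists_lt_artanh_lt le_rfl one_pos (u := (r : ℝ≥0∞))
    (by simpa using hr)
  obtain ⟨δ, hδ, hδD⟩ := Metric.nhds_basis_closedBall.mem_iff.1 (hD.mem_nhds hw.1)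
  refine ⟨δ * y, by positivity, ?_⟩
  filter_upwards [h1, h.eventually_subset (isCompact_closedBall w δ) hδD] with j hj hj' w' hw'
  have hw'δ : w' ∈ ball w δ := ball_subset_ball (by nlinarith) hw'
  refine ⟨hj' (ball_subset_closedBall hw'δ), ?_⟩
  have hle := lempert_le_of_ball_subset (ball_subset_closedBall.trans hj') hw'δ
  have hlt : ENNReal.ofReal (Real.artanh (‖w' - w‖ / δ)) ≤ r := by
    refine le_trans (ENNReal.ofReal_le_ofReal (Real.artanh_le_artanh ?_ hy1 ?_)) hyr.le
    · linarith [div_nonneg (norm_nonneg (w' - w)) hδ.le]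
    · rw [mem_ball, dist_eq_norm] at hw'
      rw [div_le_iff₀ hδ]
      linarith
  calc kobayashi (Dj j) z w' ≤ kobayashi (Dj j) z w + lempert (Dj j) w w' :=
        kobayashi_le_add_lempert _ _ _ _
    _ ≤ T + r := add_le_add hj.le (hle.trans hlt)
    _ < ENNReal.ofReal R := hrR

/-- A set containing the centre of a Kobayashi ball, and relatively open and closed in it, contains
the ball. -/
theorem kobayashiBall_subset {D S : Set (Cn n)} {z : Cn n} {R : ℝ} (hz : z ∈ D) (hzS : z ∈ S)
    (hloc : ∀ w ∈ kobayashiBall D z R, ∀ᶠ w' in 𝓝 w, w' ∈ S ↔ w ∈ S) :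
    kobayashiBall D z R ⊆ S := by
  intro w hw
  -- Membership in `S` is claimed only for `T ≤ R`, which guarantees that the chain has not left the
  -- ball.
  refine (kobayashi_induction (D := D) (z := z) (P := fun T w => kobayashi D z w < T ∧
      (T ≤ ENNReal.ofReal R → w ∈ S)) (fun T T' w hTT h => ⟨h.1.trans_le hTT, fun hR =>
      h.2 (hTT.trans hR)⟩) (fun T hT => ⟨by rwa [kobayashi_self hz], fun _ => hzS⟩)
      (fun T u φ b hφ hb hP hu => ?_) hw.2).2 le_rfl
  rw [mem_ball_zero_iff] at hb
  have hnorm : ∀ t : unitInterval, ‖((t : ℝ) : ℂ) * b‖ ≤ ‖b‖ := by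
    intro t
    rw [norm_mul, Complex.norm_real, Real.norm_eq_abs, abs_of_nonneg t.2.1]
    exact mul_le_of_le_one_left (norm_nonneg b) t.2.2
  have hk : ∀ t : unitInterval, kobayashi D z (φ ((t : ℝ) * b)) < T + u := by
    intro t
    refine (kobayashi_le_add_lempert D z (φ 0) _).trans_lt (ENNReal.add_lt_add hP.1 ?_)
    refine (lempert_le_of_isHolDisc hφ (mem_ball_zero_iff.2 ((hnorm t).trans_lt hb))).trans_lt ?_
    exact (ENNReal.ofReal_le_ofReal (Real.artanh_le_artanh
      (by linarith [norm_nonneg (((t : ℝ) : ℂ) * b)]) hb (hnorm t))).trans_lt hu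
  refine ⟨by simpa using hk 1, fun hR => ?_⟩
  -- The image of the segment from `0` to `b` stays in the ball, and the unit interval is connected.
  have hlc : IsLocallyConstant fun t : unitInterval => φ ((t : ℝ) * b) ∈ S := by
    rw [IsLocallyConstant.iff_eventually_eq]
    intro t
    have htd : ((t : ℝ) : ℂ) * b ∈ disc := mem_ball_zero_iff.2 ((hnorm t).trans_lt hb)
    have hc : ContinuousAt (fun t : unitInterval => φ ((t : ℝ) * b)) t :=
      ContinuousAt.comp (g := φ) (f := fun t : unitInterval => ((t : ℝ) : ℂ) * b)
        (hφ.1.differentiableAt (isOpen_ball.mem_nhds htd)).continuousAt (by fun_prop)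
    filter_upwards [hc.eventually (hloc _ ⟨hφ.2 htd, (hk t).trans_le hR⟩)] with s hs
    exact propext hs
  have := hlc.apply_eq_of_preconnectedSpace 0 1
  simp only [Set.Icc.coe_zero, Set.Icc.coe_one, Complex.ofReal_zero, zero_mul,
    Complex.ofReal_one, one_mul] at this
  rw [← this]
  exact hP.2 (le_self_add.trans hR)

end Kobayashi

open SeveralComplex

/-! ### Normal families in bounded or taut domains -/

section Normal

variable {n : ℕ}

/-- In a taut domain, discs with centre in a compact set map smaller discs into a compact set. -/
theorem IsTaut.exists_isCompact {D : Set (Cn n)} (hD : IsOpen D) (h : IsTaut D) {L : Set (Cn n)}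
    (hL : IsCompact L) (hLD : L ⊆ D) {ρ : ℝ} (hρ : ρ < 1) :
    ∃ L', IsCompact L' ∧ L' ⊆ D ∧ ∀ φ, IsHolDisc D φ → φ 0 ∈ L →
      ∀ ζ ∈ closedBall (0 : ℂ) ρ, φ ζ ∈ L' := by
  have : LocallyCompactSpace D := hD.locallyCompactSpace
  let K : CompactExhaustion D := default
  have hK : ∀ m, IsCompact ((↑) '' K m : Set (Cn n)) := fun m =>
    (K.isCompact m).image continuous_subtype_val
  have hKD : ∀ m, ((↑) '' K m : Set (Cn n)) ⊆ D := fun m => Subtype.coe_image_subset D (K m)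
  by_contra! hcon
  -- Discs leaving ever larger compact sets: a convergent subsequence would stay in a compact
  -- thickening of the limit image, and the centres in `L` rule out compact divergence.
  choose φ hφ hφ0 ζ hζ hout using fun m : ℕ => hcon _ (hK m) (hKD m)
  obtain ⟨s, hs, ⟨ψ, hψ, hconv⟩ | hdiv⟩ := h φ hφ
  · have hsub : closedBall (0 : ℂ) ρ ⊆ disc := closedBall_subset_ball hρ
    have hu := (tendstoLocallyUniformlyOn_iff_forall_isCompact isOpen_ball).1 hconv _ hsub
      (isCompact_closedBall _ _)
    have hcomp : IsCompact (ψ '' closedBall 0 ρ) :=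
      (isCompact_closedBall _ _).image_of_continuousOn (hψ.1.continuousOn.mono hsub)
    obtain ⟨δ, hδ, hδD⟩ := hcomp.exists_cthickening_subset_open hD
      (hψ.2.mono_left hsub).image_subset
    have hthick : IsCompact ((↑) ⁻¹' cthickening δ (ψ '' closedBall 0 ρ) : Set D) := by
      rw [Topology.IsInducing.subtypeVal.isCompact_iff, Subtype.image_preimage_coe,
        inter_eq_right.2 hδD]
      exact hcomp.cthickening
    obtain ⟨m, hm⟩ := K.exists_superset_of_isCompact hthick
    obtain ⟨j, hj, hjm⟩ := ((Metric.tendstoUniformlyOn_iff.1 hu δ hδ).and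
      (hs.tendsto_atTop.eventually_ge_atTop m)).exists
    have hmem : φ (s j) (ζ (s j)) ∈ cthickening δ (ψ '' closedBall 0 ρ) := by
      refine mem_cthickening_of_dist_le _ (ψ (ζ (s j))) _ _ (mem_image_of_mem _ (hζ _)) ?_
      rw [dist_comm]
      exact (hj _ (hζ _)).le
    exact hout (s j) ⟨⟨_, hδD hmem⟩, K.subset hjm (hm hmem), rfl⟩
  · obtain ⟨j, hj⟩ := (hdiv {0} isCompact_singleton (by simp) L hL hLD).exists
    exact Set.disjoint_left.1 hj (mem_image_of_mem _ rfl) (hφ0 (s j))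

/-- A sequence of holomorphic maps into a taut domain whose values at one point are fixed is locally
relatively compact. -/
theorem IsTaut.exists_isCompact_ball {D Ω : Set (Cn n)} (hD : IsOpen D) (h : IsTaut D)
    (hΩ : IsDomain Ω) {f : ℕ → Cn n → Cn n} (hf : ∀ j, DifferentiableOn ℂ (f j) Ω)
    (hfD : ∀ j, MapsTo (f j) Ω D) {a z : Cn n} (ha : a ∈ Ω) (hz : z ∈ D) (hfa : ∀ j, f j a = z) :
    ∀ x ∈ Ω, ∃ r > 0, ball x r ⊆ Ω ∧ ∃ L, IsCompact L ∧ L ⊆ D ∧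
      ∀ j, ∀ y ∈ ball x r, f j y ∈ L := by
  have hstep : ∀ x r, 0 < r → ball x r ⊆ Ω → (∃ L, IsCompact L ∧ L ⊆ D ∧ ∀ j, f j x ∈ L) →
      ∃ L, IsCompact L ∧ L ⊆ D ∧ ∀ j, ∀ y ∈ ball x (r / 2), f j y ∈ L := by
    rintro x r hr hrΩ ⟨L, hL, hLD, hxL⟩
    obtain ⟨L', hL', hL'D, hmaps⟩ := h.exists_isCompact hD hL hLD (ρ := 1 / 2) (by norm_num)
    refine ⟨L', hL', hL'D, fun j y hy => ?_⟩
    rw [mem_ball, dist_eq_norm] at hy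
    have hm : ∀ ζ ∈ disc, x + ζ • ((2 : ℂ) • (y - x)) ∈ Ω := by
      intro ζ hζ
      rw [mem_ball_zero_iff] at hζ
      refine hrΩ ?_
      rw [mem_ball, dist_eq_norm, add_sub_cancel_left, norm_smul, norm_smul]
      have : ‖(2 : ℂ)‖ = 2 := by simp
      rw [this]
      nlinarith [norm_nonneg ζ, norm_nonneg (y - x)]
    -- The point `y` is reached at `ζ = 1 / 2`.
    have := hmaps (fun ζ => f j (x + ζ • ((2 : ℂ) • (y - x))))
      ⟨(hf j).comp (t := Ω) (by fun_prop) hm, fun ζ hζ => hfD j (hm ζ hζ)⟩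
      (by simpa using hxL j) (1 / 2) (by simp)
    simpa [smul_smul] using this
  let S : Set (Cn n) := {x | ∃ L, IsCompact L ∧ L ⊆ D ∧ ∀ j, f j x ∈ L}
  have hV : IsOpen {x | x ∈ Ω ∧ x ∈ S} := by
    rw [isOpen_iff_eventually]
    rintro x ⟨hx, hxS⟩
    obtain ⟨r, hr, hrΩ⟩ := Metric.isOpen_iff.1 hΩ.1 x hx
    obtain ⟨L, hL, hLD, hm⟩ := hstep x r hr hrΩ hxS
    filter_upwards [ball_mem_nhds x (half_pos hr), hΩ.1.mem_nhds hx] with y hy hyΩ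
    exact ⟨hyΩ, L, hL, hLD, fun j => hm j y hy⟩
  have hW : IsOpen {x | x ∈ Ω ∧ x ∉ S} := by
    rw [isOpen_iff_eventually]
    rintro x ⟨hx, hxS⟩
    obtain ⟨r, hr, hrΩ⟩ := Metric.isOpen_iff.1 hΩ.1 x hx
    filter_upwards [ball_mem_nhds x (show 0 < r / 4 by positivity), hΩ.1.mem_nhds hx] with y hy hyΩ
    refine ⟨hyΩ, fun hyS => hxS ?_⟩
    rw [mem_ball] at hy
    obtain ⟨L, hL, hLD, hm⟩ := hstep y (r / 2) (half_pos hr)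
      ((ball_subset_ball' (by linarith)).trans hrΩ) hyS
    exact ⟨L, hL, hLD, fun j => hm j x (by rw [mem_ball, dist_comm]; linarith)⟩
  have hS : ∀ x ∈ Ω, x ∈ S := by
    intro x hx
    by_contra hxS
    obtain ⟨y, -, hy, hy'⟩ := hΩ.2.isPreconnected _ _ hV hW
      (fun y hy => (em (y ∈ S)).imp (fun h => ⟨hy, h⟩) fun h => ⟨hy, h⟩)
      ⟨a, ha, ha, {z}, isCompact_singleton, singleton_subset_iff.2 hz, fun j => hfa j⟩
      ⟨x, hx, hx, hxS⟩
    exact hy'.2 hy.2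
  intro x hx
  obtain ⟨r, hr, hrΩ⟩ := Metric.isOpen_iff.1 hΩ.1 x hx
  exact ⟨r / 2, half_pos hr, (ball_subset_ball (by linarith)).trans hrΩ,
    hstep x r hr hrΩ (hS x hx)⟩

theorem exists_forall_norm_le_of_bounded_or_taut {D Ω : Set (Cn n)} (hD : IsOpen D)
    (h : Bornology.IsBounded D ∨ IsTaut D)
    (hΩ : IsDomain Ω) {f : ℕ → Cn n → Cn n} (hf : ∀ j, DifferentiableOn ℂ (f j) Ω)
    (hfD : ∀ j, MapsTo (f j) Ω D) {a z : Cn n} (ha : a ∈ Ω) (hz : z ∈ D) (hfa : ∀ j, f j a = z) :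
    ∀ x ∈ Ω, ∃ r > 0, ∃ M, ball x r ⊆ Ω ∧ ∀ j, ∀ y ∈ ball x r, ‖f j y‖ ≤ M := by
  intro x hx
  rcases h with h | h
  · obtain ⟨M, hM⟩ := h.exists_norm_le
    obtain ⟨r, hr, hrΩ⟩ := Metric.isOpen_iff.1 hΩ.1 x hx
    exact ⟨r, hr, M, hrΩ, fun j y hy => hM _ (hfD j (hrΩ hy))⟩
  · obtain ⟨r, hr, hrΩ, L, hL, -, hm⟩ := h.exists_isCompact_ball hD hΩ hf hfD ha hz hfa x hx
    obtain ⟨M, hM⟩ := hL.isBounded.exists_norm_le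
    exact ⟨r, hr, M, hrΩ, fun j y hy => hM _ (hm j y hy)⟩

end Normal

/-! ### Preimages that stay away from the boundary -/

section Preimages

variable {n : ℕ}

/-- The points that have, for most `j`, a preimage under `f j` in a fixed compact subset of `Ω`. -/
def boundedPreimage (Ω : Set (Cn n)) (f : ℕ → Cn n → Cn n) (l : Filter ℕ) : Set (Cn n) :=
  {w | ∃ K, IsCompact K ∧ K ⊆ Ω ∧ ∀ᶠ j in l, w ∈ f j '' K}

theorem exists_tendsto_of_mem_boundedPreimage {Ω : Set (Cn n)} {f : ℕ → Cn n → Cn n}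
    {𝒰 : Ultrafilter ℕ} (hi : ∀ j, InjOn (f j) Ω) {w : Cn n} (hw : w ∈ boundedPreimage Ω f 𝒰) :
    ∃ x ∈ Ω, Tendsto (fun j => Function.invFunOn (f j) Ω w) 𝒰 (𝓝 x) ∧
      ∀ᶠ j in (𝒰 : Filter ℕ), f j (Function.invFunOn (f j) Ω w) = w := by
  obtain ⟨K, hK, hKΩ, hev⟩ := hw
  have hev' : ∀ᶠ j in (𝒰 : Filter ℕ), Function.invFunOn (f j) Ω w ∈ K ∧
      f j (Function.invFunOn (f j) Ω w) = w := by
    filter_upwards [hev] with j hj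
    obtain ⟨x, hx, rfl⟩ := hj
    rw [(hi j).leftInvOn_invFunOn (hKΩ hx)]
    exact ⟨hx, rfl⟩
  obtain ⟨x, hx, hlim⟩ := hK.ultrafilter_le_nhds (𝒰.map fun j => Function.invFunOn (f j) Ω w)
    (le_principal_iff.2 (hev'.mono fun j hj => hj.1))
  exact ⟨x, hKΩ hx, hlim, hev'.mono fun j hj => hj.2⟩

/-- By homogeneity, preimages of nearby points stay together at a uniform scale. -/
theorem exists_mem_boundedPreimage_of_norm_lt {Ω : Set (Cn n)} (hΩ : IsOpen Ω)
    (hΩb : Bornology.IsBounded Ω) (hΩh : IsHomogeneous Ω) {a : Cn n} (ha : a ∈ Ω)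
    {f : ℕ → Cn n → Cn n} {𝒰 : Ultrafilter ℕ} (hf : ∀ j, DifferentiableOn ℂ (f j) Ω)
    (hi : ∀ j, InjOn (f j) Ω) :
    ∃ η > 0, η < 1 ∧ ∀ w w' : Cn n, ∀ ρ > 0, (∀ᶠ j in (𝒰 : Filter ℕ), ball w ρ ⊆ f j '' Ω) →
      ‖w' - w‖ < η * ρ → w ∈ boundedPreimage Ω f 𝒰 → w' ∈ boundedPreimage Ω f 𝒰 := by
  obtain ⟨M, hM0, hM⟩ := hΩb.exists_pos_norm_le
  obtain ⟨σ, hσ, hσΩ⟩ := Metric.nhds_basis_closedBall.mem_iff.1 (hΩ.mem_nhds ha)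
  -- `1 / 2` keeps `w'` in the half ball; `σ / (8 * M)` turns the Lipschitz constant `2 * M / (ρ /
  -- 2)` into a displacement of at most `σ / 2`.
  refine ⟨min (1 / 2) (σ / (8 * M)), by positivity, (min_le_left _ _).trans_lt (by norm_num),
    fun w w' ρ hρ hball hww' hw => ?_⟩
  have hw1 : ‖w' - w‖ < ρ / 2 := hww'.trans_le <| by
    have := min_le_left (1 / 2 : ℝ) (σ / (8 * M))
    nlinarith
  have hw2 : 2 * M / (ρ / 2) * ‖w' - w‖ ≤ σ / 2 := by
    have h1 : ‖w' - w‖ ≤ σ / (8 * M) * ρ := hww'.le.trans (by gcongr; exact min_le_right _ _)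
    calc 2 * M / (ρ / 2) * ‖w' - w‖ ≤ 2 * M / (ρ / 2) * (σ / (8 * M) * ρ) := by gcongr
      _ = σ / 2 := by field_simp; norm_num
  obtain ⟨x, hx, hlim, hright⟩ := exists_tendsto_of_mem_boundedPreimage hi hw
  -- Moving the limit preimage to `a` lets one `σ`, hence one `η`, serve every `w`.
  obtain ⟨θ, ⟨hθd, hθm, ψ, hψd, hψm, hinv⟩, hθx⟩ := hΩh x hx a ha
  refine ⟨ψ '' closedBall a σ, (isCompact_closedBall a σ).image_of_continuousOn
    (hψd.continuousOn.mono hσΩ), (hψm.mono_left hσΩ).image_subset, ?_⟩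
  have hθc : Tendsto (fun j => θ (Function.invFunOn (f j) Ω w)) 𝒰 (𝓝 a) := by
    have := (hθd.differentiableAt (hΩ.mem_nhds hx)).continuousAt.tendsto
    rw [hθx] at this
    exact this.comp hlim
  filter_upwards [hball, Metric.tendsto_nhds.1 hθc (σ / 2) (half_pos hσ)] with j hj hjσ
  have hleft : LeftInvOn (Function.invFunOn (f j) Ω) (f j) Ω := (hi j).leftInvOn_invFunOn
  have hgm : MapsTo (Function.invFunOn (f j) Ω) (f j '' Ω) Ω := by
    rintro _ ⟨y, hy, rfl⟩
    rwa [hleft hy]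
  have hgd := differentiableOn_of_leftInvOn rfl hΩ (hf j) hleft
  have hcomp : DifferentiableOn ℂ (fun y => θ (Function.invFunOn (f j) Ω y)) (ball w ρ) :=
    (hθd.comp hgd hgm).mono hj
  have hlip := norm_sub_le_of_forall_norm_le (x := w) (y := w) (z := w') (s := ρ / 2) (r := ρ / 2)
    (M := M) (half_pos hρ) (by rwa [add_halves])
    (by rw [add_halves]; exact fun y hy => hM _ (hθm (hgm (hj hy))))
    (mem_ball_self (half_pos hρ)) (by rwa [mem_ball, dist_eq_norm])
  have hw'im : w' ∈ f j '' Ω := hj (by rw [mem_ball, dist_eq_norm]; linarith)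
  obtain ⟨y, hy, rfl⟩ := hw'im
  rw [hleft hy] at hlip
  refine ⟨y, ⟨θ y, ?_, hinv.1 hy⟩, rfl⟩
  rw [mem_closedBall]
  have := dist_triangle (θ y) (θ (Function.invFunOn (f j) Ω w)) a
  rw [dist_eq_norm (θ y) (θ (Function.invFunOn (f j) Ω w))] at this
  linarith

end Preimages

/-! ### Passage to the limit and the theorem -/

section Main

variable {n : ℕ}

/-- If the Kobayashi balls of radius `R` in the exhausting domains are covered by injective images
of `Ω`, then so is the one in the limit domain. -/
theorem exists_injHol_of_exhausts {Ω D : Set (Cn n)} (hΩ : IsDomain Ω)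
    (hΩb : Bornology.IsBounded Ω) (hΩh : IsHomogeneous Ω) (hD : IsDomain D)
    (hDbt : Bornology.IsBounded D ∨ IsTaut D) {Dj : ℕ → Set (Cn n)} (hDj : Exhausts Dj D)
    {z : Cn n} (hz : z ∈ D) (hzj : ∀ j, z ∈ Dj j) {R : ℝ} (hR : 0 < R)
    (hcov : ∀ j, ∃ f ∈ injHol Ω (Dj j), kobayashiBall (Dj j) z R ⊆ f '' Ω) :
    ∃ f ∈ injHol Ω D, kobayashiBall D z R ⊆ f '' Ω := by
  obtain ⟨a, ha⟩ := hΩ.2.nonempty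
  have hcov' : ∀ j, ∃ f ∈ injHol Ω (Dj j), kobayashiBall (Dj j) z R ⊆ f '' Ω ∧ f a = z := by
    intro j
    obtain ⟨f, ⟨hfd, hfm, hfi⟩, hfb⟩ := hcov j
    obtain ⟨x, hx, hxz⟩ := hfb ⟨hzj j, by rw [kobayashi_self (hzj j)]; simpa using hR⟩
    obtain ⟨θ, ⟨hθd, hθm, ψ, -, hψm, hinv⟩, hθa⟩ := hΩh a ha x hx
    refine ⟨f ∘ θ, ⟨hfd.comp hθd hθm, hfm.comp hθm, hfi.comp hinv.1.injOn hθm⟩, ?_, ?_⟩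
    · rw [image_comp, (hinv.2.surjOn hψm).image_eq_of_mapsTo hθm]
      exact hfb
    · rw [Function.comp_apply, hθa, hxz]
  choose f hf hball hfa using hcov'
  have hfd := fun j => (hf j).1
  have hfi := fun j => (hf j).2.2
  have hfD : ∀ j, MapsTo (f j) Ω D := fun j x hx => (hDj.1 j).2 ((hf j).2.1 hx)
  let 𝒰 : Ultrafilter ℕ := Ultrafilter.of atTop
  have h𝒰 : (𝒰 : Filter ℕ) ≤ atTop := Ultrafilter.of_le atTop
  obtain ⟨g, hg⟩ := exists_tendstoUniformlyOnBalls 𝒰 hfd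
    (exists_forall_norm_le_of_bounded_or_taut hD.1 hDbt hΩ hfd hfD ha hz hfa)
  have hsub : ∀ w ∈ kobayashiBall D z R, ∃ ρ > 0,
      ∀ᶠ j in (𝒰 : Filter ℕ), ball w ρ ⊆ f j '' Ω := by
    intro w hw
    obtain ⟨ρ, hρ, hev⟩ := eventually_ball_subset_kobayashiBall hD.1 hDj hz hw
    exact ⟨ρ, hρ, (hev.filter_mono h𝒰).mono fun j hj => hj.trans (hball j)⟩
  have hzB : z ∈ kobayashiBall D z R := ⟨hz, by rw [kobayashi_self hz]; simpa using hR⟩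
  have hga : Function.Injective (fderiv ℂ g a) := by
    obtain ⟨ε, hε, hev⟩ := hsub z hzB
    obtain ⟨M, hM⟩ := hΩb.exists_norm_le
    refine (injective_iff_map_eq_zero _).2 fun v hv => ?_
    have hle : ‖v‖ ≤ 2 * M / ε * ‖fderiv ℂ g a v‖ := by
      have ht : Tendsto (fun j => 2 * M / ε * ‖fderiv ℂ (f j) a v‖) 𝒰
          (𝓝 (2 * M / ε * ‖fderiv ℂ g a v‖)) :=
        (((ContinuousLinearMap.apply ℂ (Cn n) v).continuous.tendsto _).comp
          ((hg.fderiv hfd).tendsto_at ha)).norm.const_mul _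
      refine ge_of_tendsto ht (hev.mono fun j hj => ?_)
      exact norm_le_mul_norm_fderiv rfl hΩ.1 (hfd j) (hfi j) hε hM ha (by rwa [hfa j]) v
    rw [hv, norm_zero, mul_zero] at hle
    exact norm_le_zero_iff.1 hle
  obtain ⟨hgi, hgim⟩ := injOn_of_tendstoUniformlyOnBalls hΩ.1 hΩ.2.isPreconnected hfd hfi hg ha hga
  refine ⟨g, ⟨hg.differentiableOn hfd, fun p hp => ?_, hgi⟩, ?_⟩
  -- A limit value might lie on the boundary of `D`; being attained by some `f j`, it does not.
  · obtain ⟨j, x, hx, hxe⟩ := (hgim p hp).exists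
    rw [← hxe]
    exact hfD j hx
  have hS : kobayashiBall D z R ⊆ boundedPreimage Ω f 𝒰 := by
    obtain ⟨η, hη, hη1, hstep⟩ := exists_mem_boundedPreimage_of_norm_lt (𝒰 := 𝒰) hΩ.1 hΩb hΩh ha
      hfd hfi
    refine kobayashiBall_subset hz ⟨{a}, isCompact_singleton, singleton_subset_iff.2 ha,
      Eventually.of_forall fun j => ⟨a, rfl, hfa j⟩⟩ fun w hw => ?_
    obtain ⟨ρ, hρ, hev⟩ := hsub w hw
    filter_upwards [ball_mem_nhds w (show 0 < η * (ρ / 2) by positivity)] with w' hw'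
    rw [mem_ball, dist_eq_norm] at hw'
    constructor
    -- Relative closedness: with `η` independent of the point, the roles of `w` and `w'` can be
    -- exchanged, as `ball w' (ρ / 2)` is still covered.
    · refine hstep w' w (ρ / 2) (half_pos hρ) (hev.mono fun j hj => ?_) (by rwa [norm_sub_rev])
      refine (ball_subset_ball' ?_).trans hj
      rw [dist_eq_norm]
      nlinarith
    · exact hstep w w' ρ hρ hev (by nlinarith)
  intro w hw
  obtain ⟨x, hx, hlim, hright⟩ := exists_tendsto_of_mem_boundedPreimage hfi (hS hw)
  refine ⟨x, hx, ?_⟩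
  obtain ⟨r, hr, hrΩ, hu⟩ := hg x hx
  have hgc : ContinuousAt g x :=
    ((hg.differentiableOn hfd).differentiableAt (hΩ.1.mem_nhds hx)).continuousAt
  have ht : Tendsto (fun j => f j (Function.invFunOn (f j) Ω w)) 𝒰 (𝓝 (g x)) :=
    tendsto_comp_of_locally_uniform_limit hgc hlim fun u hu' =>
      ⟨ball x r, ball_mem_nhds x hr, hu u hu'⟩
  exact tendsto_nhds_unique ht (tendsto_const_nhds.congr' (hright.mono fun j hj => hj.symm))

theorem ofReal_le_inv_fridmanH {Ω D : Set (Cn n)} {z : Cn n} {r : ℝ} (hr : 0 < r)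
    (h : ∃ f ∈ injHol Ω D, kobayashiBall D z r ⊆ f '' Ω) :
    ENNReal.ofReal r ≤ (fridmanH Ω D z)⁻¹ := by
  rw [← inv_inv (ENNReal.ofReal r), ENNReal.inv_le_inv, ← ENNReal.ofReal_inv_of_pos hr,
    ← one_div]
  exact sInf_le ⟨r, hr, h, rfl⟩

/-- The infimum need not be attained, but a strict inequality leaves room for an admissible radius
above `R`. -/
theorem exists_of_lt_inv_fridmanH {Ω D : Set (Cn n)} {z : Cn n} {R : ℝ} (hR : 0 < R)
    (h : ENNReal.ofReal R < (fridmanH Ω D z)⁻¹) :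
    ∃ f ∈ injHol Ω D, kobayashiBall D z R ⊆ f '' Ω := by
  rw [ENNReal.lt_inv_iff_lt_inv, ← ENNReal.ofReal_inv_of_pos hR] at h
  obtain ⟨_, ⟨r, hr, ⟨f, hf, hball⟩, rfl⟩, hlt⟩ := sInf_lt_iff.1 h
  have hlt' := (ENNReal.ofReal_lt_ofReal_iff (by positivity)).1 hlt
  rw [one_div, inv_lt_inv₀ hr hR] at hlt'
  exact ⟨f, hf, fun w hw => hball ⟨hw.1, hw.2.trans_le (ENNReal.ofReal_le_ofReal hlt'.le)⟩⟩

theorem lt_tanhExt_iff {x : ℝ≥0∞} {c : ℝ} (hc0 : 0 < c) (hc1 : c < 1) :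
    c < tanhExt x ↔ ENNReal.ofReal (Real.artanh c) < x := by
  unfold tanhExt
  split_ifs with h
  · simp [h, hc1]
  · have hc : c ∈ Ioo (-1 : ℝ) 1 := ⟨by linarith, hc1⟩
    have hx : Real.tanh x.toReal ∈ Ioo (-1 : ℝ) 1 :=
      ⟨Real.neg_one_lt_tanh _, Real.tanh_lt_one _⟩
    rw [← Real.artanh_lt_artanh_iff hc hx, Real.artanh_tanh,
      ENNReal.ofReal_lt_iff_lt_toReal (Real.artanh_nonneg hc0.le) h]

end Main

end Fridman

theorem mainTheorem3 {n : ℕ} (hn : 1 ≤ n) (Ω D : Set (Fridman.Cn n))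
    (hΩ : Fridman.IsDomain Ω) (hΩb : Bornology.IsBounded Ω) (hΩh : Fridman.IsHomogeneous Ω)
    (hD : Fridman.IsDomain D) (hDh : Fridman.IsKobayashiHyperbolic D)
    (hDbt : Bornology.IsBounded D ∨ Fridman.IsTaut D)
    (Dj : ℕ → Set (Fridman.Cn n)) (hDj : Fridman.Exhausts Dj D)
    (z : Fridman.Cn n) (hz : z ∈ D) :
    limsup (fun j => Fridman.fridman Ω (Dj j) z) atTop ≤ Fridman.fridman Ω D z := by
  by_contra! hlt
  obtain ⟨c, hc, hclim⟩ := exists_between hlt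
  have hfreq : ∃ᶠ j in atTop, c < Fridman.fridman Ω (Dj j) z := by
    refine frequently_lt_of_lt_limsup ?_ hclim
    exact isCoboundedUnder_le_of_le atTop (x := 0) fun j =>
      (Fridman.fridman_mem_Icc Ω (Dj j) z).1
  have hc0 : 0 < c := (Fridman.fridman_mem_Icc Ω D z).1.trans_lt hc
  have hc1 : c < 1 := by
    obtain ⟨j, hj⟩ := hfreq.exists
    exact hj.trans_le (Fridman.fridman_mem_Icc Ω (Dj j) z).2
  have hR : 0 < Real.artanh c := Real.artanh_pos ⟨hc0, hc1⟩
  obtain ⟨s, hs, hsP⟩ := extraction_of_frequently_atTop (hfreq.and_eventually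
    (hDj.eventually_subset isCompact_singleton (singleton_subset_iff.2 hz)))
  have hDs : Fridman.Exhausts (fun j => Dj (s j)) D := by
    refine ⟨fun j => hDj.1 (s j), fun K hK hKD => ?_⟩
    obtain ⟨N, hN⟩ := hDj.2 K hK hKD
    exact ⟨N, fun j hj => hN _ (hj.trans_le (hs.id_le j))⟩
  have hcov := Fridman.exists_injHol_of_exhausts hΩ hΩb hΩh hD hDbt hDs hz
    (fun j => singleton_subset_iff.1 (hsP j).2) hR fun j =>
      Fridman.exists_of_lt_inv_fridmanH hR ((Fridman.lt_tanhExt_iff hc0 hc1).1 (hsP j).1)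
  have hle := Fridman.ofReal_le_inv_fridmanH hR hcov
  -- The covering gives only a weak inequality at `c`; stepping down to `c'` makes it strict.
  obtain ⟨c', hc', hcc'⟩ := exists_between hc
  have hc'0 : 0 < c' := (Fridman.fridman_mem_Icc Ω D z).1.trans_lt hc'
  have hart : Real.artanh c' < Real.artanh c := Real.artanh_lt_artanh (by linarith) hc1 hcc'
  refine lt_asymm hc' ((Fridman.lt_tanhExt_iff hc'0 (hcc'.trans hc1)).2 (lt_of_lt_of_le ?_ hle))
  exact (ENNReal.ofReal_lt_ofReal_iff hR).2 hart
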